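/- Let $V$ be a finite set, let $G$ be an undirected graph (resp. an acyclic directed graph) with vertex set $V$, and let $B,D,E,M\subseteq V$. Conventions. Undirected case: $Z$ separates $X$ and $Y$, written $X\perp Y\mid Z$, if every path from a vertex of $X$ to a vertex of $Y$ (paths with one vertex included) has a vertex, possibly an end, in $Z$. Directed case: a trail is a sequence of vertices in which consecutive vertices are joined by an arc in one of the two directions; an interior vertex of it is a v-structure if both neighbouring arcs of the trail point to it; the trail is active given $Z$ if none of its vertices that is not a v-structure belongs to $Z$, and each of its v-structures belongs to $Z$ or has a descendant in $Z$; and $Z$ d-separates $X$ and $Y$, written $X\perp Y\mid Z$, if no trail from $X$ to $Y$ is active given $Z$. A (d-)separator between $B$ and $D$ given $E$ is a set $N\subseteq V$ with $B\perp D\mid N\cup E$; it is minimal if no strict subset of it is a (d-)separator between $B$ and $D$ given $E$. The ascendant closure of a set consists of its vertices and all their ascendants. The Markov blanket $\mathrm{mb}_C(B\mid E)$ of $B$ in $C$ given $E$ is the subset of $C$ such that, for all $N\subseteq C$, $$\mathrm{mb}_C(B\mid E)\subseteq N\iff X_B \text{ is independent from } X_{C\setminus(B\cup N)} \text{ given }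 X_{N\cup E}\text{ for every distribution that factorizes on } G,$$ where the distributions are those of families $(X_v)_{v\in V}$ of random variables with values in arbitrary finite sets. Factorizing on $G$ means being a normalized product of nonnegative functions $\psi_K(x_K)$ over a collection of cliques $K$ of $G$ in the undirected case, and being a product over $v\in V$ of conditional distributions of $X_v$ given its parents in the directed case. Theorem. Suppose that $M$ is a (d-)separator between $B$ and $D$ given $E$ that contains no vertex of $(B\cup D)\setminus E$ and, in the directed case, that $M$ is contained in the ascendant closure of $B\cup D\cup E$. Then the Markov blankets $\mathrm{mb}_M(B\mid E)$ and $$M_1=\mathrm{mb}_{\mathrm{mb}_M(B\mid E)}(D\mid E)$$ exist, and $M_1$ is a minimal (d-)separator between $B$ and $D$ given $E$ such that $$M_1\perp D\mid M_2\cup E\quad\text{for every (d-)separator } M_2\subseteq M \text{ between } B \text{ and } D \text{ given } E.$$ Moreover, $M_1$ is the only minimal (d-)separator between $B$ and $D$ given $E$ contained in $M$ with this property. -/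

import Mathlib

namespace PGM

/-! ### Separation in undirected graphs and d-separation in directed graphs -/

/-- `M` separates `X` and `Y` in the undirected graph `G`: no path from `X` to `Y` is active
given `M`, that is, every path from `X` to `Y` has a vertex (possibly an end) in `M`. -/
def Separates {V : Type*} (G : SimpleGraph V) (X Y M : Set V) : Prop :=
  ∀ x ∈ X, ∀ y ∈ Y, ∀ w : G.Walk x y, ∃ v ∈ w.support, v ∈ M

/-- A directed graph is acyclic if it has no directed cycle (of positive length). -/
def IsAcyclic {V : Type*} (G : Digraph V) : Prop :=
  ∀ v, ¬ Relation.TransGen G.Adj v v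

/-- The ascendant closure of `C`: the vertices of `C` and their ascendants. -/
def ascClosure {V : Type*} (G : Digraph V) (C : Set V) : Set V :=
  {u | ∃ v ∈ C, Relation.ReflTransGen G.Adj u v}

/-- The descendant closure of a vertex `v`: `v` and its descendants. -/
def dscClosure {V : Type*} (G : Digraph V) (v : V) : Set V :=
  {w | Relation.ReflTransGen G.Adj v w}

/-- The sequence `t 0, …, t k` is a trail: consecutive vertices are joined by an arc, in one of
the two directions. -/
def IsTrail {V : Type*} (G : Digraph V) (k : ℕ) (t : ℕ → V) : Prop :=
  ∀ i < k, G.Adj (t i) (t (i + 1)) ∨ G.Adj (t (i + 1)) (t i)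

/-- The trail `t 0, …, t k` has a v-structure at position `i`. -/
def IsVStructure {V : Type*} (G : Digraph V) (k : ℕ) (t : ℕ → V) (i : ℕ) : Prop :=
  0 < i ∧ i < k ∧ G.Adj (t (i - 1)) (t i) ∧ G.Adj (t (i + 1)) (t i)

/-- The trail `t 0, …, t k` is active given `M`: no vertex of it that is not a v-structure is in
`M`, and every v-structure of it is in `M` or has a descendant in `M`. -/
def IsActiveTrail {V : Type*} (G : Digraph V) (k : ℕ) (t : ℕ → V) (M : Set V) : Prop :=
  IsTrail G k t ∧ ∀ i ≤ k,
    (¬ IsVStructure G k t i → t i ∉ M) ∧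
    (IsVStructure G k t i → (dscClosure G (t i) ∩ M).Nonempty)

/-- `M` d-separates `X` and `Y` in the directed graph `G`: no trail from `X` to `Y` is active
given `M`. -/
def DSeparates {V : Type*} (G : Digraph V) (X Y M : Set V) : Prop :=
  ∀ (k : ℕ) (t : ℕ → V), t 0 ∈ X → t k ∈ Y → ¬ IsActiveTrail G k t M

/-! ### Separators between two sets given an evidence set

Here `sep X Y M` is either `Separates G X Y M` or `DSeparates G X Y M`. -/

/-- `M` is a (d-)separator between `B` and `D` given `E`. -/
def IsSeparator {V : Type*} (sep : Set V → Set V → Set V → Prop) (B D E M : Set V) : Prop :=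
  sep B D (M ∪ E)

/-- `M` is a minimal (d-)separator between `B` and `D` given `E`. -/
def IsMinimalSeparator {V : Type*} (sep : Set V → Set V → Set V → Prop)
    (B D E M : Set V) : Prop :=
  IsSeparator sep B D E M ∧ ∀ M' : Set V, M' ⊂ M → ¬ IsSeparator sep B D E M'

/-- `N` is a minimal (d-)separator between `B` and `D` given `E` such that `N ⊥ D | M₂ ∪ E` for
every (d-)separator `M₂` between `B` and `D` given `E` that is contained in `M`. -/
def IsNearestSeparator {V : Type*} (sep : Set V → Set V → Set V → Prop)
    (B D E M N : Set V) : Prop :=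
  IsMinimalSeparator sep B D E N ∧
    ∀ M₂ : Set V, M₂ ⊆ M → IsSeparator sep B D E M₂ → sep N D (M₂ ∪ E)

/-! ### Distributions of finitely many discrete variables and conditional independence

`S v` is the finite set of values of the variable `X_v`; a distribution of `X_V` is an element of
`stdSimplex ℝ (∀ v, S v)`. -/

/-- The probability of the event `s` under the probability mass function `p`. -/
noncomputable def prob {Ω : Type*} [Fintype Ω] (p : Ω → ℝ) (s : Set Ω) : ℝ :=
  ∑ ω, s.indicator p ω

/-- The event `X_A = x_A`. -/
def agree {V : Type*} {S : V → Type} (A : Set V) (x : ∀ v, S v) : Set (∀ v, S v) :=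
  {ω | ∀ v ∈ A, ω v = x v}

/-- `X_A` is independent from `X_B` given `X_C` under `p`: for all values `x_A`, `y_B`, `z_C`,
`P(X_A = x_A, X_B = y_B, X_C = z_C) P(X_C = z_C) = P(X_A = x_A, X_C = z_C) P(X_B = y_B, X_C = z_C)`.
The sets may overlap. -/
def CondIndep {V : Type*} [Fintype V] [DecidableEq V] {S : V → Type} [∀ v, Fintype (S v)]
    (p : (∀ v, S v) → ℝ) (A B C : Set V) : Prop :=
  ∀ x y z : ∀ v, S v,
    prob p (agree A x ∩ agree B y ∩ agree C z) * prob p (agree C z) =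
      prob p (agree A x ∩ agree C z) * prob p (agree B y ∩ agree C z)

/-- `p` factorizes as an undirected graphical model on `G`: it is a normalized product of
nonnegative functions `ψ C` of `x_C`, where `C` ranges over a collection of cliques of `G`. -/
def UFactorizes {V : Type*} (G : SimpleGraph V) {S : V → Type} (p : (∀ v, S v) → ℝ) : Prop :=
  ∃ (𝒞 : Finset (Finset V)) (ψ : (C : Finset V) → ((v : {v // v ∈ C}) → S v) → ℝ) (Z : ℝ),
    (∀ C ∈ 𝒞, G.IsClique (C : Set V)) ∧
    (∀ C ∈ 𝒞, ∀ x, 0 ≤ ψ C x) ∧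
    ∀ x, p x = 1 / Z * ∏ C ∈ 𝒞, ψ C (fun v => x v)

/-- `p` factorizes as a directed graphical model on `G`: it is the product over the vertices `v` of
conditional distributions `k v a y` of `X_v = a` given the values `y` of the parents of `v`. -/
def DFactorizes {V : Type*} [Fintype V] (G : Digraph V) {S : V → Type} [∀ v, Fintype (S v)]
    (p : (∀ v, S v) → ℝ) : Prop :=
  ∃ k : (v : V) → S v → ((u : {u // G.Adj u v}) → S u) → ℝ,
    (∀ v y, (fun a => k v a y) ∈ stdSimplex ℝ (S v)) ∧
    ∀ x, p x = ∏ v, k v (x v) (fun u => x u)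

/-- `X_A` is independent from `X_B` given `X_C` for any distribution (with any finite sets of
values) that factorizes as an undirected graphical model on `G`. -/
def UIndep {V : Type*} [Fintype V] [DecidableEq V] (G : SimpleGraph V) (A B C : Set V) : Prop :=
  ∀ (S : V → Type) [∀ v, Fintype (S v)] (p : (∀ v, S v) → ℝ),
    p ∈ stdSimplex ℝ (∀ v, S v) → UFactorizes G p → CondIndep p A B C

/-- `X_A` is independent from `X_B` given `X_C` for any distribution (with any finite sets of
values) that factorizes as a directed graphical model on `G`. -/
def DIndep {V : Type*} [Fintype V] [DecidableEq V] (G : Digraph V) (A B C : Set V) : Prop :=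
  ∀ (S : V → Type) [∀ v, Fintype (S v)] (p : (∀ v, S v) → ℝ),
    p ∈ stdSimplex ℝ (∀ v, S v) → DFactorizes G p → CondIndep p A B C

/-! ### The Markov blanket in a set

Here `ind A B C` is either `UIndep G A B C` or `DIndep G A B C`. -/

/-- `N` is the Markov blanket `mb_C(B|E)` of `B` in `C` given `E`: it is a subset of `C`, and a
subset `M` of `C` satisfies `X_B ⫫ X_{C \ (B ∪ M)} | X_{M ∪ E}` for any distribution that
factorizes on the graph if and only if `M` contains `N`. -/
def IsMarkovBlanketIn {V : Type*} (ind : Set V → Set V → Set V → Prop)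
    (C B E N : Set V) : Prop :=
  N ⊆ C ∧ ∀ M : Set V, M ⊆ C → (ind B (C \ (B ∪ M)) (M ∪ E) ↔ N ⊆ M)

/-- There is at most one Markov blanket of `B` in `C` given `E`. -/
theorem IsMarkovBlanketIn.unique {V : Type*} {ind : Set V → Set V → Set V → Prop}
    {C B E N N' : Set V} (h : IsMarkovBlanketIn ind C B E N)
    (h' : IsMarkovBlanketIn ind C B E N') : N = N' :=
  Set.Subset.antisymm ((h.2 N' h'.1).1 ((h'.2 N' h'.1).2 subset_rfl))
    ((h'.2 N h.1).1 ((h.2 N h.1).2 subset_rfl))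

end PGM

/-! Independence in all distributions that factorize on the graph is equivalent to (d-)separation,
so Markov blankets are a matter of walks. Moreover, d-separation of X and Y given Z is separation in
the moral graph of the ascendant closure of X ∪ Y ∪ Z. As M lies in the ascendant closure A of B ∪ D
∪ E, the separations to be compared can be read in the one moral graph of A. `IsGraphical` is the
common ground of the two cases.

The blanket of B in C is the set `frontier` of the vertices of C where walks from B that avoid E can
first enter C. With M' = mb_M(B|E), each m in M₁ is thus joined to B by a walk that meets M ∪ E at m
only, and to D by a walk that meets M' ∪ E at m only. Chained together, the two walks show that no
separator inside M₁ omits m: M₁ is minimal. A walk from m to D avoiding M₂ ∪ E would extend back to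
B, so M₁ is nearest. If N is another nearest separator and m lies in M₁ but not in N, the walk from
D to m, stopped where it first meets N ∪ {m}, contradicts the nearness of M₁ or of N; so M₁ ⊆ N, and
N is minimal. This is `exists_nearest`.

Separation implies independence because two configurations can exchange their values on the part
that C cuts off from B (`condIndep_of_prod`). For the converse only supports matter
(`not_condIndep`): a bit is carried from A to B, by a constraint of equality along edges, or by a
`Model` that copies it along an active trail and uses exclusive or at v-structures. -/

namespace PGM

/-! ### Walks avoiding a set of vertices -/

/-- There is a walk from `x` to `y` in `H` that avoids `Z`. -/
inductive Joined {V : Type*} (H : SimpleGraph V) (Z : Set V) (x : V) : V → Prop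
  | refl : x ∉ Z → Joined H Z x x
  | tail {y w : V} : Joined H Z x y → H.Adj y w → w ∉ Z → Joined H Z x w

namespace Joined

variable {V : Type*} {H H' : SimpleGraph V} {Z Z' W : Set V} {x y w : V}

theorem left_notMem (h : Joined H Z x y) : x ∉ Z := by
  induction h with
  | refl h => exact h
  | tail _ _ _ ih => exact ih

theorem right_notMem (h : Joined H Z x y) : y ∉ Z := by
  cases h <;> assumption

theorem mono (h : Joined H Z x y) (hH : H ≤ H') (hZ : Z' ⊆ Z) : Joined H' Z' x y := by
  induction h with
  | refl h => exact .refl fun h' => h (hZ h')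
  | tail _ ha hw ih => exact .tail ih (hH ha) fun h' => hw (hZ h')

theorem anti (h : Joined H Z x y) (hZ : Z' ⊆ Z) : Joined H Z' x y := h.mono le_rfl hZ

theorem trans (h : Joined H Z x y) (h' : Joined H Z y w) : Joined H Z x w := by
  induction h' with
  | refl _ => exact h
  | tail _ ha hw ih => exact .tail ih ha hw

theorem symm (h : Joined H Z x y) : Joined H Z y x := by
  induction h with
  | refl h => exact .refl h
  | tail h ha hw ih => exact (Joined.tail (.refl hw) ha.symm h.right_notMem).trans ih

/-- The first vertex in `W` of a walk that avoids `Z`. -/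
theorem first_hit (h : Joined H Z x y) (W : Set V) :
    Joined H (Z ∪ W) x y ∨ ∃ w ∈ W, w ∉ Z ∧ Joined H ((Z ∪ W) \ {w}) x w := by
  induction h with
  | refl h =>
    by_cases hx : x ∈ W
    · exact .inr ⟨x, hx, h, .refl fun h' => h'.2 rfl⟩
    · exact .inl (.refl fun h' => h'.elim h hx)
  | @tail y w _ ha hw ih =>
    rcases ih with ih | ih
    · by_cases hx : w ∈ W
      · exact .inr ⟨w, hx, hw, .tail (ih.anti Set.sdiff_subset) ha fun h' => h'.2 rfl⟩
      · exact .inl (.tail ih ha fun h' => h'.elim hw hx)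
    · exact .inr ih

theorem exists_walk (h : Joined H Z x y) : ∃ p : H.Walk x y, ∀ v ∈ p.support, v ∉ Z := by
  induction h with
  | refl h => exact ⟨.nil, by simpa using h⟩
  | tail _ ha hw ih =>
    obtain ⟨p, hp⟩ := ih
    refine ⟨p.concat ha, fun v hv => ?_⟩
    rw [SimpleGraph.Walk.support_concat] at hv
    simp only [List.mem_append, List.mem_singleton] at hv
    rcases hv with hv | rfl
    · exact hp v hv
    · exact hw

theorem of_walk (p : H.Walk x y) (hp : ∀ v ∈ p.support, v ∉ Z) : Joined H Z x y := by
  induction p with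
  | nil => exact .refl (hp _ (by simp))
  | cons ha p ih =>
    have h1 := ih fun v hv => hp v (by simp [hv])
    exact (Joined.tail (.refl h1.left_notMem) ha.symm (hp _ (by simp))).symm.trans h1

end Joined

variable {V : Type*}

theorem separates_iff {H : SimpleGraph V} {X Y Z : Set V} :
    Separates H X Y Z ↔ ∀ x ∈ X, ∀ y ∈ Y, ¬ Joined H Z x y := by
  refine forall₂_congr fun x _ => forall₂_congr fun y _ => ⟨fun h hj => ?_, fun h p => ?_⟩
  · obtain ⟨p, hp⟩ := hj.exists_walk
    obtain ⟨v, hv, hZ⟩ := h p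
    exact hp v hv hZ
  · by_contra! hc
    exact h (.of_walk p hc)

theorem Separates.symm {H : SimpleGraph V} {X Y Z : Set V} (h : Separates H X Y Z) :
    Separates H Y X Z := by
  rw [separates_iff] at h ⊢
  exact fun y hy x hx hj => h x hx y hy hj.symm

theorem Separates.mono {H H' : SimpleGraph V} {X X' Y Y' Z : Set V} (h : Separates H X Y Z)
    (hH : H' ≤ H) (hX : X' ⊆ X) (hY : Y' ⊆ Y) : Separates H' X' Y' Z := by
  rw [separates_iff] at h ⊢
  exact fun x hx y hy hj => h x (hX hx) y (hY hy) (hj.mono hH subset_rfl)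

theorem Separates.union_left {H : SimpleGraph V} {X X' Y Z : Set V} (h : Separates H X Y Z)
    (h' : Separates H X' Y Z) : Separates H (X ∪ X') Y Z :=
  fun x hx => hx.elim (h x) (h' x)

theorem Separates.contraction {H : SimpleGraph V} {X Y Z W : Set V} (h : Separates H X W Z)
    (h' : Separates H X Y (Z ∪ W)) : Separates H X Y Z := by
  rw [separates_iff] at h h' ⊢
  intro x hx y hy hj
  rcases hj.first_hit W with hj | ⟨w, hw, hwZ, hj⟩
  · exact h' x hx y hy hj
  · refine h x hx w hw (hj.anti fun v hv => ⟨.inl hv, ?_⟩)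
    rintro rfl
    exact hwZ hv

/-! ### Markov blankets for undirected separation -/

/-- The vertices of `C` that are joined to `B` by a walk without other vertices in `C ∪ E`. -/
def frontier (H : SimpleGraph V) (C B E : Set V) : Set V :=
  {v ∈ C | ∃ b ∈ B, Joined H (C \ {v} ∪ E) b v}

theorem frontier_subset {H : SimpleGraph V} {C B E : Set V} : frontier H C B E ⊆ C :=
  fun _ h => h.1

/-- A frontier vertex is the end of a walk avoiding `E`, hence is not in `B`; outside `M`, it would
violate the separation. Conversely, the first vertex in `C` of a walk that avoids `M ∪ E` is a
frontier vertex outside `M`. -/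
theorem separates_iff_frontier_subset {H : SimpleGraph V} {C B E M : Set V} (hB : C ∩ B ⊆ E)
    (hM : M ⊆ C) :
    Separates H B (C \ (B ∪ M)) (M ∪ E) ↔ frontier H C B E ⊆ M := by
  rw [separates_iff]
  constructor
  · rintro h v ⟨hvC, b, hb, hj⟩
    by_contra hvM
    have hvE : v ∉ E := fun h' => hj.right_notMem (.inr h')
    refine h b hb v ⟨hvC, ?_⟩ (hj.anti ?_)
    · rintro (h' | h')
      · exact hvE (hB ⟨hvC, h'⟩)
      · exact hvM h'
    · rintro u (hu | hu)
      · exact .inl ⟨hM hu, by rintro rfl; exact hvM hu⟩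
      · exact .inr hu
  · intro h b hb v hv hj
    rcases hj.first_hit C with hj | ⟨w, hw, hwZ, hj⟩
    · exact hj.right_notMem (.inr hv.1)
    · refine hwZ (.inl (h ⟨hw, b, hb, hj.anti ?_⟩))
      rintro u (hu | hu)
      · exact ⟨.inr hu.1, hu.2⟩
      · refine ⟨.inl (.inr hu), ?_⟩
        rintro rfl
        exact hwZ (.inr hu)

/-! ### Nearest separators -/

/-- A separation relation `sep` that amounts to separation in an undirected graph `H A` depending
on the closure `A` of the sets concerned, where `ind` is the corresponding independence. -/
structure IsGraphical (sep ind : Set V → Set V → Set V → Prop) (a : ClosureOperator (Set V))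
    (H : Set V → SimpleGraph V) : Prop where
  mono : Monotone H
  sep_iff : ∀ X Y Z, sep X Y Z ↔ Separates (H (a (X ∪ Y ∪ Z))) X Y Z
  contraction : ∀ X Y Z W, sep X W Z → sep X Y (Z ∪ W) → sep X Y Z
  union_left : ∀ X X' Y Z, sep X Y Z → sep X' Y Z → sep (X ∪ X') Y Z
  ind_iff : ∀ X Y Z, ind X Y Z ↔ sep X Y Z

namespace IsGraphical

variable {sep ind : Set V → Set V → Set V → Prop} {a : ClosureOperator (Set V)}
  {H : Set V → SimpleGraph V}

theorem symm (h : IsGraphical sep ind a H) {X Y Z : Set V} (hs : sep X Y Z) : sep Y X Z := by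
  rw [h.sep_iff] at hs ⊢
  rw [Set.union_comm Y X]
  exact hs.symm

theorem mono_left (h : IsGraphical sep ind a H) {X X' Y Z : Set V} (hs : sep X Y Z)
    (hX : X' ⊆ X) : sep X' Y Z := by
  rw [h.sep_iff] at hs ⊢
  exact hs.mono (h.mono (a.monotone (by gcongr))) hX subset_rfl

/-- The union of the three sets is `B ∪ C ∪ E` whatever `M` is, so a single graph tests all
candidates. -/
theorem isMarkovBlanketIn (h : IsGraphical sep ind a H) {C B E : Set V} (hB : C ∩ B ⊆ E) :
    IsMarkovBlanketIn ind C B E (frontier (H (a (B ∪ C ∪ E))) C B E) := by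
  refine ⟨frontier_subset, fun M hM => ?_⟩
  rw [h.ind_iff, h.sep_iff, ← separates_iff_frontier_subset hB hM]
  have : B ∪ C \ (B ∪ M) ∪ (M ∪ E) = B ∪ C ∪ E := by
    ext v
    have := @hM v
    simp only [Set.mem_union, Set.mem_sdiff]
    tauto
  rw [this]

/-- A Markov blanket of `B` in a separator `C` between `B` and `D` is a separator. -/
theorem isSeparator_of_isMarkovBlanketIn (h : IsGraphical sep ind a H) {C B D E N : Set V}
    (hB : C ∩ B ⊆ E) (hC : IsSeparator sep B D E C) (hN : IsMarkovBlanketIn ind C B E N) :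
    IsSeparator sep B D E N := by
  have h1 := (h.ind_iff _ _ _).1 ((hN.2 N hN.1).2 subset_rfl)
  refine h.contraction _ _ _ _ h1 ?_
  have : N ∪ E ∪ C \ (B ∪ N) = C ∪ E := by
    ext v
    have := @hN.1 v
    have := @hB v
    simp only [Set.mem_union, Set.mem_sdiff, Set.mem_inter_iff] at *
    tauto
  rw [this]
  exact hC

theorem exists_nearest (h : IsGraphical sep ind a H) {B D E M : Set V} (hM : M ∩ (B ∪ D) ⊆ E)
    (hsep : IsSeparator sep B D E M) (hA : M ⊆ a (B ∪ D ∪ E)) :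
    ∃ M' M₁ : Set V,
      IsMarkovBlanketIn ind M B E M' ∧ IsMarkovBlanketIn ind M' D E M₁ ∧
      IsNearestSeparator sep B D E M M₁ ∧
      ∀ N : Set V, N ⊆ M → IsNearestSeparator sep B D E M N → N = M₁ := by
  set A := a (B ∪ D ∪ E) with hAdef
  have hBDE : B ∪ D ∪ E ⊆ A := a.le_closure _
  have hle : ∀ X : Set V, X ⊆ A → H (a X) ≤ H A := fun X hX =>
    h.mono (a.le_closure_iff.1 hX)
  -- Thanks to `B ⊆ X`, the closure involved is exactly `A`. This is why `B` is added to `M₁` and to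
  -- `N` below.
  have key : ∀ X Z, B ⊆ X → X ⊆ A → Z ⊆ A →
      (sep X D (Z ∪ E) ↔ Separates (H A) X D (Z ∪ E)) := by
    intro X Z hBX hX hZ
    have : a (X ∪ D ∪ (Z ∪ E)) = A := by
      apply le_antisymm
      · refine a.le_closure_iff.1 ?_
        rintro v ((hv | hv) | (hv | hv))
        exacts [hX hv, hBDE (.inl (.inr hv)), hZ hv, hBDE (.inr hv)]
      · refine a.monotone ?_
        rintro v ((hv | hv) | hv)
        exacts [.inl (.inl (hBX hv)), .inl (.inr hv), .inr (.inr hv)]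
    rw [h.sep_iff, this]
  have hBA : B ⊆ A := fun v hv => hBDE (.inl (.inl hv))
  have hMB : M ∩ B ⊆ E := fun v hv => hM ⟨hv.1, .inl hv.2⟩
  set M' := frontier (H (a (B ∪ M ∪ E))) M B E with hM'def
  have hM'M : M' ⊆ M := frontier_subset
  have hM'D : M' ∩ D ⊆ E := fun v hv => hM ⟨hM'M hv.1, .inr hv.2⟩
  set M₁ := frontier (H (a (D ∪ M' ∪ E))) M' D E with hM₁def
  have hM₁M' : M₁ ⊆ M' := frontier_subset
  have hM₁M : M₁ ⊆ M := hM₁M'.trans hM'M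
  have hmb' : IsMarkovBlanketIn ind M B E M' := h.isMarkovBlanketIn hMB
  have hmb₁ : IsMarkovBlanketIn ind M' D E M₁ := h.isMarkovBlanketIn hM'D
  have hs' : IsSeparator sep B D E M' := h.isSeparator_of_isMarkovBlanketIn hMB hsep hmb'
  have hs₁ : IsSeparator sep B D E M₁ :=
    h.symm (h.isSeparator_of_isMarkovBlanketIn hM'D (h.symm hs') hmb₁)
  have toB : ∀ m ∈ M₁, ∃ b ∈ B, Joined (H A) (M \ {m} ∪ E) b m := by
    intro m hm
    obtain ⟨-, b, hb, hj⟩ := hM₁M' hm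
    refine ⟨b, hb, hj.mono (hle _ ?_) subset_rfl⟩
    rintro v ((hv | hv) | hv)
    exacts [hBA hv, hA hv, hBDE (.inr hv)]
  have toD : ∀ m ∈ M₁, ∃ d ∈ D, Joined (H A) (M' \ {m} ∪ E) d m := by
    rintro m ⟨-, d, hd, hj⟩
    refine ⟨d, hd, hj.mono (hle _ ?_) subset_rfl⟩
    rintro v ((hv | hv) | hv)
    exacts [hBDE (.inl (.inr hv)), hA (hM'M hv), hBDE (.inr hv)]
  have avoid : ∀ {m : V} {N C : Set V}, m ∉ N → N ⊆ C → N ∪ E ⊆ C \ {m} ∪ E := by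
    rintro m N C hm hN v (hv | hv)
    · exact .inl ⟨hN hv, by rintro rfl; exact hm hv⟩
    · exact .inr hv
  have hmin : IsMinimalSeparator sep B D E M₁ := by
    refine ⟨hs₁, fun N hN hNs => ?_⟩
    obtain ⟨m, hm, hmN⟩ := Set.exists_of_ssubset hN
    have hNs := separates_iff.1 ((key B N subset_rfl hBA
      ((hN.subset.trans hM₁M).trans hA)).1 hNs)
    obtain ⟨b, hb, hjb⟩ := toB m hm
    obtain ⟨d, hd, hjd⟩ := toD m hm
    exact hNs b hb d hd ((hjb.anti (avoid hmN (hN.subset.trans hM₁M))).trans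
      (hjd.anti (avoid hmN (hN.subset.trans hM₁M'))).symm)
  have hnear : ∀ M₂ : Set V, M₂ ⊆ M → IsSeparator sep B D E M₂ →
      Separates (H A) (B ∪ M₁) D (M₂ ∪ E) := by
    intro M₂ hM₂ hs₂
    have hs₂ := (key B M₂ subset_rfl hBA (hM₂.trans hA)).1 hs₂
    refine hs₂.union_left ?_
    rw [separates_iff] at hs₂ ⊢
    intro m hm d hd hj
    have hmN : m ∉ M₂ := fun h' => hj.left_notMem (.inl h')
    obtain ⟨b, hb, hjb⟩ := toB m hm
    exact hs₂ b hb d hd ((hjb.anti (avoid hmN hM₂)).trans hj)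
  have hM₁A : B ∪ M₁ ⊆ A := Set.union_subset hBA (hM₁M.trans hA)
  refine ⟨M', M₁, hmb', hmb₁, ⟨hmin, fun M₂ hM₂ hs₂ => ?_⟩, ?_⟩
  · exact h.mono_left ((key _ _ Set.subset_union_left hM₁A (hM₂.trans hA)).2 (hnear M₂ hM₂ hs₂))
      Set.subset_union_right
  · rintro N hNM ⟨⟨hNs, hNmin⟩, hN⟩
    -- Nearness of `M₁` with respect to `N`, then of `N` with respect to `M₁`.
    have h1 := separates_iff.1 (hnear N hNM hNs)
    have h2 := separates_iff.1 ((key (B ∪ N) M₁ Set.subset_union_left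
      (Set.union_subset hBA (hNM.trans hA)) (hM₁M.trans hA)).1
      (h.union_left _ _ _ _ hs₁ (hN M₁ hM₁M hs₁)))
    have hsub : M₁ ⊆ N := by
      intro m hm
      by_contra hmN
      obtain ⟨d, hd, hj⟩ := toD m hm
      replace hj : Joined (H A) (M₁ \ {m} ∪ E) d m :=
        hj.anti (Set.union_subset_union_left _ (Set.sdiff_subset_sdiff_left hM₁M'))
      -- Stopped at `m`, the walk contradicts `h1`; stopped at another vertex, which is in `N`, it
      -- contradicts `h2`.
      rcases hj.first_hit (N ∪ {m}) with hj | ⟨w, hw, hwZ, hj⟩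
      · exact hj.right_notMem (.inr (.inr rfl))
      · by_cases hwm : w = m
        · subst hwm
          refine h1 w (.inr hm) d hd (hj.anti ?_).symm
          rintro v (hv | hv)
          · exact ⟨.inr (.inl hv), by rintro rfl; exact hmN hv⟩
          · exact ⟨.inl (.inr hv), by rintro rfl; exact hwZ (.inr hv)⟩
        · refine h2 w (.inr (hw.resolve_right hwm)) d hd (hj.anti ?_).symm
          rintro v hv
          refine ⟨?_, ?_⟩
          · rcases hv with hv | hv
            · by_cases hvm : v = m
              · exact .inr (.inr hvm)
              · exact .inl (.inl ⟨hv, hvm⟩)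
            · exact .inl (.inr hv)
          · rintro rfl
            exact hwZ (hv.imp_left fun hv => ⟨hv, hwm⟩)
    by_contra hne
    exact hNmin M₁ (hsub.ssubset_of_ne (Ne.symm hne)) hs₁

end IsGraphical

end PGM

namespace PGM

variable {V : Type*}

/-! ### Active trails as a reachability relation -/

/-- `Reach G X Z v d`: there is a trail from `X` to `v`, active given `Z` at all its vertices
before `v`, whose last arc points to `v` if `d` is true; if `d` is false, then `v ∉ Z`, and the
trail has length zero or its last arc leaves `v`. -/
inductive Reach (G : Digraph V) (X Z : Set V) : V → Bool → Prop
  | start {x : V} : x ∈ X → x ∉ Z → Reach G X Z x false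
  | down {u w : V} {d : Bool} : Reach G X Z u d → u ∉ Z → G.Adj u w → Reach G X Z w true
  | up {u w : V} : Reach G X Z u false → G.Adj w u → w ∉ Z → Reach G X Z w false
  | collide {u w : V} : Reach G X Z u true → (dscClosure G u ∩ Z).Nonempty → G.Adj w u → w ∉ Z →
      Reach G X Z w false

theorem IsAcyclic.asymm {G : Digraph V} (hG : IsAcyclic G) {u v : V} (h : G.Adj u v) :
    ¬ G.Adj v u :=
  fun h' => hG u (.tail (.single h) h')

/-- By acyclicity, a vertex that an arc of the trail leaves is not a v-structure. The second
conjunct remembers the arc into `t i`, which makes `t i` a v-structure if the next arc also points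
to it. -/
theorem Reach.of_isActiveTrail {G : Digraph V} (hG : IsAcyclic G) {X Z : Set V} {k : ℕ}
    {t : ℕ → V} (ht : IsActiveTrail G k t Z) (h0 : t 0 ∈ X) (i : ℕ) (hi : i ≤ k) :
    ∃ d, Reach G X Z (t i) d ∧ (d = true → 0 < i ∧ G.Adj (t (i - 1)) (t i)) := by
  induction i with
  | zero =>
    exact ⟨false, .start h0 ((ht.2 0 hi).1 fun h => lt_irrefl _ h.1), by simp⟩
  | succ i ih =>
    obtain ⟨d, hr, hd⟩ := ih (by omega)
    rcases ht.1 i (by omega) with ha | ha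
    · refine ⟨true, hr.down ((ht.2 i (by omega)).1 fun h => hG.asymm ha h.2.2.2) ha, fun _ => ?_⟩
      simpa using ha
    · have hZ : t (i + 1) ∉ Z :=
        (ht.2 (i + 1) hi).1 fun h => hG.asymm ha (by simpa using h.2.2.1)
      refine ⟨false, ?_, by simp⟩
      cases d with
      | false => exact hr.up ha hZ
      | true => exact hr.collide ((ht.2 i (by omega)).2 ⟨(hd rfl).1, by omega, (hd rfl).2, ha⟩) ha hZ

theorem Reach.exists_trail {G : Digraph V} (hG : IsAcyclic G) {X Z : Set V} {u : V} {d : Bool}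
    (h : Reach G X Z u d) :
    ∃ (k : ℕ) (t : ℕ → V), t 0 ∈ X ∧ t k = u ∧ IsTrail G k t ∧
      (∀ i < k, (¬ IsVStructure G k t i → t i ∉ Z) ∧
        (IsVStructure G k t i → (dscClosure G (t i) ∩ Z).Nonempty)) ∧
      (d = true → 0 < k ∧ G.Adj (t (k - 1)) (t k)) ∧
      (d = false → 0 < k → G.Adj (t k) (t (k - 1))) := by
  -- Activity is recorded only before position `k`, since the next arc decides whether `t k` is a
  -- v-structure. Appending `w` does not affect the earlier positions.
  have extend : ∀ (k : ℕ) (t : ℕ → V) (w : V), IsTrail G k t →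
      (∀ i < k, (¬ IsVStructure G k t i → t i ∉ Z) ∧
        (IsVStructure G k t i → (dscClosure G (t i) ∩ Z).Nonempty)) →
      (G.Adj (t k) w ∨ G.Adj w (t k)) →
      (¬ (0 < k ∧ G.Adj (t (k - 1)) (t k) ∧ G.Adj w (t k)) → t k ∉ Z) →
      (0 < k ∧ G.Adj (t (k - 1)) (t k) ∧ G.Adj w (t k) → (dscClosure G (t k) ∩ Z).Nonempty) →
      ∃ t' : ℕ → V, t' 0 = t 0 ∧ t' k = t k ∧ t' (k + 1) = w ∧ IsTrail G (k + 1) t' ∧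
        ∀ i < k + 1, (¬ IsVStructure G (k + 1) t' i → t' i ∉ Z) ∧
          (IsVStructure G (k + 1) t' i → (dscClosure G (t' i) ∩ Z).Nonempty) := by
    intro k t w htr hact hadj hn hv
    have hle : ∀ i ≤ k, (fun j => if j ≤ k then t j else w) i = t i := fun i hi => if_pos hi
    have hlast : (fun j => if j ≤ k then t j else w) (k + 1) = w := if_neg (by omega)
    generalize (fun j => if j ≤ k then t j else w) = t' at hle hlast
    refine ⟨t', hle 0 (by omega), hle k le_rfl, hlast, fun i hi => ?_, fun i hi => ?_⟩
    · rcases Nat.lt_succ_iff_lt_or_eq.1 hi with hi | rfl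
      · rw [hle i hi.le, hle (i + 1) hi]
        exact htr i hi
      · rw [hle i le_rfl, hlast]
        exact hadj
    · unfold IsVStructure
      rcases Nat.lt_succ_iff_lt_or_eq.1 hi with hi' | rfl
      · rw [hle i hi'.le, hle (i + 1) hi', hle (i - 1) (by omega)]
        have := hact i hi'
        unfold IsVStructure at this
        simpa only [hi, hi', true_and] using this
      · rw [hle i le_rfl, hlast, hle (i - 1) (by omega)]
        simp only [hi, true_and]
        exact ⟨hn, hv⟩
  have notMem : ∀ {u : V}, Reach G X Z u false → u ∉ Z := by
    intro u h
    cases h <;> assumption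
  induction h with
  | @start x hx hxZ =>
    exact ⟨0, fun _ => x, hx, rfl, by simp [IsTrail], by simp, by simp, by simp⟩
  | @down u w d hr hu ha ih =>
    obtain ⟨k, t, h0, rfl, htr, hact, -, -⟩ := ih
    obtain ⟨t', e0, ek, e1, htr', hact'⟩ := extend k t w htr hact (.inl ha) (fun _ => hu)
      (fun h => (hG.asymm ha h.2.2).elim)
    refine ⟨k + 1, t', e0 ▸ h0, e1, htr', hact', fun _ => ⟨by omega, ?_⟩, by simp⟩
    rwa [Nat.add_sub_cancel, ek, e1]
  | @up u w hr ha hw ih =>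
    obtain ⟨k, t, h0, rfl, htr, hact, -, h2⟩ := ih
    obtain ⟨t', e0, ek, e1, htr', hact'⟩ := extend k t w htr hact (.inr ha)
      (fun _ => notMem hr) (fun h => (hG.asymm h.2.1 (h2 rfl h.1)).elim)
    refine ⟨k + 1, t', e0 ▸ h0, e1, htr', hact', by simp, fun _ _ => ?_⟩
    rwa [Nat.add_sub_cancel, ek, e1]
  | @collide u w hr hne ha hw ih =>
    obtain ⟨k, t, h0, rfl, htr, hact, h1, -⟩ := ih
    obtain ⟨t', e0, ek, e1, htr', hact'⟩ := extend k t w htr hact (.inr ha)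
      (fun h => (h ⟨(h1 rfl).1, (h1 rfl).2, ha⟩).elim) (fun _ => hne)
    refine ⟨k + 1, t', e0 ▸ h0, e1, htr', hact', by simp, fun _ _ => ?_⟩
    rwa [Nat.add_sub_cancel, ek, e1]

theorem dSeparates_iff {G : Digraph V} (hG : IsAcyclic G) {X Y Z : Set V} :
    DSeparates G X Y Z ↔ ∀ y ∈ Y, ∀ d, Reach G X Z y d → y ∈ Z := by
  constructor
  · intro h y hy d hr
    by_contra hyZ
    obtain ⟨k, t, h0, rfl, htr, hact, -, -⟩ := hr.exists_trail hG
    refine h k t h0 hy ⟨htr, fun i hi => ?_⟩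
    rcases hi.lt_or_eq with hi | rfl
    · exact hact i hi
    · exact ⟨fun _ => hyZ, fun h => absurd h.2.1 (lt_irrefl _)⟩
  · intro h k t h0 hk ht
    obtain ⟨d, hr, -⟩ := Reach.of_isActiveTrail hG ht h0 k le_rfl
    exact (ht.2 k le_rfl).1 (fun h => absurd h.2.1 (lt_irrefl _)) (h _ hk d hr)

theorem DSeparates.union_left {G : Digraph V} {X X' Y Z : Set V} (h : DSeparates G X Y Z)
    (h' : DSeparates G X' Y Z) : DSeparates G (X ∪ X') Y Z :=
  fun k t h0 hk => h0.elim (fun h0 => h k t h0 hk) (fun h0 => h' k t h0 hk)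

/-- The moral graphs of the hypotheses and of the conclusion differ, so the argument is on trails:
by `h`, a trail active given `Z` meets `W` outside `Z` nowhere, hence stays active given `Z ∪ W`. -/
theorem DSeparates.contraction {G : Digraph V} (hG : IsAcyclic G) {X Y Z W : Set V}
    (h : DSeparates G X W Z) (h' : DSeparates G X Y (Z ∪ W)) : DSeparates G X Y Z := by
  rw [dSeparates_iff hG] at h h' ⊢
  have key : ∀ u d, Reach G X Z u d → Reach G X (Z ∪ W) u d := by
    intro u d hr
    have aux : ∀ {v d}, Reach G X Z v d → v ∉ Z → v ∉ Z ∪ W := fun hr hv hw =>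
      hw.elim hv fun hw => hv (h _ hw _ hr)
    induction hr with
    | start hx hZ => exact .start hx (aux (.start hx hZ) hZ)
    | down hr hu ha ih => exact ih.down (aux hr hu) ha
    | up hr ha hw ih => exact ih.up ha (aux (hr.up ha hw) hw)
    | collide hr hne ha hw ih =>
      exact ih.collide (hne.mono (by gcongr; exact Set.subset_union_left)) ha
        (aux (hr.collide hne ha hw) hw)
  intro y hy d hr
  rcases h' y hy d (key y d hr) with hZ | hW
  · exact hZ
  · exact h y hW d hr

/-! ### Moralization -/

/-- The moral graph of the subgraph on `A`: two vertices are joined if they belong to the family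
(a vertex and its parents) of a vertex in `A`. -/
def moralGraph (G : Digraph V) (A : Set V) : SimpleGraph V where
  Adj u w := u ≠ w ∧ ∃ v ∈ A, (u = v ∨ G.Adj u v) ∧ (w = v ∨ G.Adj w v)
  symm := ⟨fun _ _ h => ⟨h.1.symm, h.2.imp fun _ h => ⟨h.1, h.2.2, h.2.1⟩⟩⟩
  loopless := ⟨fun _ h => h.1 rfl⟩

theorem moralGraph_mono (G : Digraph V) : Monotone (moralGraph G) :=
  fun _ _ hA _ _ h => ⟨h.1, h.2.imp fun _ h => ⟨hA h.1, h.2⟩⟩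

/-- The ascendant closure as a closure operator. -/
def ascClosureOperator (G : Digraph V) : ClosureOperator (Set V) :=
  ClosureOperator.mk' (ascClosure G)
    (fun _ _ h _ hu => hu.imp fun _ hv => ⟨h hv.1, hv.2⟩)
    (fun _ v hv => ⟨v, hv, .refl⟩)
    (fun _ _ hu => by
      obtain ⟨v, ⟨w, hw, hvw⟩, huv⟩ := hu
      exact ⟨w, hw, huv.trans hvw⟩)

theorem mem_ascClosure_of_adj {G : Digraph V} {C : Set V} {u v : V} (h : G.Adj u v)
    (hv : v ∈ ascClosure G C) : u ∈ ascClosure G C :=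
  hv.imp fun _ hw => ⟨hw.1, .head h hw.2⟩

theorem subset_ascClosure {G : Digraph V} {C : Set V} : C ⊆ ascClosure G C :=
  fun v hv => ⟨v, hv, .refl⟩

/-- A vertex without descendants in `Z` is reached from a descendant of it in `X`. -/
theorem Reach.of_descendant {G : Digraph V} {X Z : Set V} {v x : V} (hx : x ∈ X)
    (hvx : Relation.ReflTransGen G.Adj v x) (hZ : ¬ (dscClosure G v ∩ Z).Nonempty) :
    Reach G X Z v false := by
  induction hvx using Relation.ReflTransGen.head_induction_on with
  | refl => exact .start hx fun h => hZ ⟨_, .refl, h⟩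
  | head ha _ ih =>
    exact .up (ih fun ⟨z, hz, hz'⟩ => hZ ⟨z, .head ha hz, hz'⟩) ha fun h => hZ ⟨_, .refl, h⟩

theorem Reach.descendant {G : Digraph V} {X Z : Set V} {v y : V} {d : Bool}
    (h : Reach G X Z v d) (hvy : Relation.ReflTransGen G.Adj v y)
    (hZ : ¬ (dscClosure G v ∩ Z).Nonempty) : ∃ d', Reach G X Z y d' := by
  induction hvy with
  | refl => exact ⟨d, h⟩
  | tail hvu ha ih =>
    obtain ⟨d', hr⟩ := ih
    exact ⟨true, hr.down (fun h => hZ ⟨_, hvu, h⟩) ha⟩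

/-- A vertex that a walk in the moral graph joins to `X` is reached by an active trail. -/
theorem Reach.of_joined {G : Digraph V} {X Y Z : Set V}
    (hY : ∀ y ∈ Y, ∀ d, Reach G X Z y d → y ∈ Z) {x u : V} (hx : x ∈ X)
    (h : Joined (moralGraph G (ascClosure G (X ∪ Y ∪ Z))) Z x u) : ∃ d, Reach G X Z u d := by
  -- The problem is a `v` entered by an arc to it and without descendants in `Z`. Being in the
  -- closure, it has a descendant in `X`, from which another trail climbs to `v`, or in `Y`, which
  -- would be reached outside `Z`.
  have climb : ∀ {v b : V} {d : Bool}, v ∈ ascClosure G (X ∪ Y ∪ Z) → Reach G X Z v d →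
      G.Adj b v → b ∉ Z → Reach G X Z b false := by
    intro v b d hv hr ha hb
    cases d with
    | false => exact hr.up ha hb
    | true =>
      by_cases hne : (dscClosure G v ∩ Z).Nonempty
      · exact hr.collide hne ha hb
      · obtain ⟨w, (hw | hw) | hw, hvw⟩ := hv
        · exact (Reach.of_descendant hw hvw hne).up ha hb
        · obtain ⟨d', hr'⟩ := hr.descendant hvw hne
          exact (hne ⟨w, hvw, hY w hw d' hr'⟩).elim
        · exact (hne ⟨w, hvw, hw⟩).elim
  induction h with
  | refl h => exact ⟨false, .start hx h⟩
  | @tail a b hj hab hb ih =>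
    obtain ⟨d, hr⟩ := ih
    obtain ⟨-, v, hv, hav, hbv⟩ := hab
    obtain ⟨d', hr'⟩ : ∃ d', Reach G X Z v d' := by
      rcases hav with rfl | hav
      · exact ⟨d, hr⟩
      · exact ⟨true, hr.down hj.right_notMem hav⟩
    rcases hbv with rfl | hbv
    · exact ⟨d', hr'⟩
    · exact ⟨false, climb hv hr' hbv hb⟩

/-- Read backwards from `u`, the arcs descend until the start of the trail, in `X`, or a
v-structure, which has a descendant in `Z`. -/
theorem Reach.mem_ascClosure {G : Digraph V} {X Z C : Set V} (hC : X ∪ Z ⊆ C) {u : V} {d : Bool}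
    (h : Reach G X Z u d) (hd : d = false) : u ∈ ascClosure G C := by
  induction h with
  | start hx _ => exact subset_ascClosure (hC (.inl hx))
  | down => simp at hd
  | up _ ha _ ih => exact mem_ascClosure_of_adj ha (ih rfl)
  | collide _ hne ha _ _ =>
    obtain ⟨z, hz, hzZ⟩ := hne
    exact mem_ascClosure_of_adj ha ⟨z, hC (.inr hzZ), hz⟩

/-- A vertex reached by an active trail is joined to `X`, or else has a parent joined to `X`. -/
theorem Reach.exists_joined {G : Digraph V} {X Y Z : Set V} {u : V} {d : Bool}
    (h : Reach G X Z u d) (hu : u ∈ ascClosure G (X ∪ Y ∪ Z)) :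
    ∃ x ∈ X, ∃ w, Joined (moralGraph G (ascClosure G (X ∪ Y ∪ Z))) Z x w ∧
      (w = u ∨ d = true ∧ G.Adj w u) := by
  -- Two members of one family are equal or adjacent in the moral graph.
  have extend : ∀ {x w b v : V}, Joined (moralGraph G (ascClosure G (X ∪ Y ∪ Z))) Z x w →
      v ∈ ascClosure G (X ∪ Y ∪ Z) → (w = v ∨ G.Adj w v) → (b = v ∨ G.Adj b v) → b ∉ Z →
      Joined (moralGraph G (ascClosure G (X ∪ Y ∪ Z))) Z x b := by
    intro x w b v hj hv hwv hbv hb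
    by_cases hwb : w = b
    · exact hwb ▸ hj
    · exact hj.tail ⟨hwb, v, hv, hwv, hbv⟩ hb
  induction h with
  | @start x hx hZ => exact ⟨x, hx, x, .refl hZ, .inl rfl⟩
  | @down u w d hr huZ ha ih =>
    have hu' := mem_ascClosure_of_adj ha hu
    obtain ⟨x, hx, v, hj, hv⟩ := ih hu'
    exact ⟨x, hx, u, extend hj hu' (hv.imp_right And.right) (.inl rfl) huZ, .inr ⟨rfl, ha⟩⟩
  | @up u w hr ha hw ih =>
    have hu' : u ∈ ascClosure G (X ∪ Y ∪ Z) := by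
      refine hr.mem_ascClosure ?_ rfl
      gcongr
      exact Set.subset_union_left
    obtain ⟨x, hx, v, hj, hv⟩ := ih hu'
    exact ⟨x, hx, w, extend hj hu' (hv.imp_right And.right) (.inr ha) hw, .inl rfl⟩
  | @collide u w hr hne ha hw ih =>
    have hu' : u ∈ ascClosure G (X ∪ Y ∪ Z) := by
      obtain ⟨z, hz, hzZ⟩ := hne
      exact ⟨z, .inr hzZ, hz⟩
    obtain ⟨x, hx, v, hj, hv⟩ := ih hu'
    exact ⟨x, hx, w, extend hj hu' (hv.imp_right And.right) (.inr ha) hw, .inl rfl⟩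

/-- The moral edge between the parents of a v-structure bypasses it; conversely, a trail follows a
moral edge through the common child. -/
theorem dSeparates_iff_separates {G : Digraph V} (hG : IsAcyclic G) {X Y Z : Set V} :
    DSeparates G X Y Z ↔ Separates (moralGraph G (ascClosure G (X ∪ Y ∪ Z))) X Y Z := by
  rw [dSeparates_iff hG, separates_iff]
  constructor
  · intro h x hx y hy hj
    obtain ⟨d, hr⟩ := Reach.of_joined h hx hj
    exact hj.right_notMem (h y hy d hr)
  · intro h y hy d hr
    by_contra hyZ
    have hyA : y ∈ ascClosure G (X ∪ Y ∪ Z) := subset_ascClosure (.inl (.inr hy))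
    obtain ⟨x, hx, w, hj, hw⟩ := hr.exists_joined hyA
    by_cases hwy : w = y
    · exact h x hx y hy (hwy ▸ hj)
    · exact h x hx y hy (hj.tail ⟨hwy, y, hyA, .inr (hw.resolve_left hwy).2, .inl rfl⟩ hyZ)

end PGM

namespace PGM

/-! ### Conditional independence -/

section CondIndep

variable {V : Type*} [Fintype V] [DecidableEq V] {S : V → Type} [∀ v, Fintype (S v)]

/-- Two products of a function of `x_{Qᶜ}` and a function of `x_{Q ∪ C}`, all of them supported on
`X_C = z_C`, can exchange their second factors. -/
theorem sum_mul_sum_exchange {C Q : Set V} (hQC : Disjoint Q C) (z : ∀ v, S v)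
    {f f' g g' : (∀ v, S v) → ℝ}
    (hf : ∀ ω ω', (∀ v ∉ Q, ω v = ω' v) → f ω = f ω')
    (hf' : ∀ ω ω', (∀ v ∉ Q, ω v = ω' v) → f' ω = f' ω')
    (hg : ∀ ω ω', (∀ v ∈ Q ∪ C, ω v = ω' v) → g ω = g ω')
    (hg' : ∀ ω ω', (∀ v ∈ Q ∪ C, ω v = ω' v) → g' ω = g' ω')
    (hfz : ∀ ω ∉ agree C z, f ω = 0) (hfz' : ∀ ω ∉ agree C z, f' ω = 0) :
    (∑ ω, f ω * g ω) * ∑ ω, f' ω * g' ω = (∑ ω, f ω * g' ω) * ∑ ω, f' ω * g ω := by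
  classical
  rw [Fintype.sum_mul_sum, Fintype.sum_mul_sum, ← Fintype.sum_prod_type', ← Fintype.sum_prod_type']
  let mix : (∀ v, S v) → (∀ v, S v) → ∀ v, S v := fun ω ω' v => if v ∈ Q then ω' v else ω v
  -- `e` exchanges the coordinates in `Q` of two configurations, and so those in `Q ∪ C` when both
  -- agree with `z` on `C`.
  let e : (∀ v, S v) × (∀ v, S v) ≃ (∀ v, S v) × (∀ v, S v) :=
    Function.Involutive.toPerm (fun q => (mix q.1 q.2, mix q.2 q.1)) (by
      rintro ⟨ω, ω'⟩
      refine Prod.ext (funext fun v => ?_) (funext fun v => ?_) <;>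
        by_cases hv : v ∈ Q <;> simp [mix, hv])
  have hmixf : ∀ ω ω', ∀ v ∉ Q, mix ω ω' v = ω v := fun ω ω' v hv => if_neg hv
  have hmixg : ∀ ω ω', ω ∈ agree C z → ω' ∈ agree C z → ∀ v ∈ Q ∪ C, mix ω ω' v = ω' v := by
    rintro ω ω' hω hω' v (hv | hv)
    · exact if_pos hv
    · rw [hmixf _ _ _ fun h => Set.disjoint_left.1 hQC h hv, hω v hv, hω' v hv]
  rw [← Equiv.sum_comp e]
  refine Finset.sum_congr rfl fun q _ => ?_
  obtain ⟨ω, ω'⟩ := q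
  change f (mix ω ω') * g (mix ω ω') * (f' (mix ω' ω) * g' (mix ω' ω)) = _
  rw [hf _ _ (hmixf ω ω'), hf' _ _ (hmixf ω' ω)]
  by_cases hω : ω ∈ agree C z
  · by_cases hω' : ω' ∈ agree C z
    · rw [hg _ _ (hmixg _ _ hω hω'), hg' _ _ (hmixg _ _ hω' hω)]
      ring
    · simp [hfz' _ hω']
  · simp [hfz _ hω]

/-- A distribution proportional to a product of factors is such that `X_A` is independent from
`X_B` given `X_C` if there is a set `K` containing `A \ C` and disjoint from `B` such that the
factors that depend on a variable in `K` depend on the variables in `K ∪ C` only. -/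
theorem condIndep_of_prod {ι : Type*} (s : Finset ι) (φ : ι → (∀ v, S v) → ℝ) (F : ι → Set V)
    (hF : ∀ i ∈ s, ∀ ω ω', (∀ v ∈ F i, ω v = ω' v) → φ i ω = φ i ω')
    {A B C K : Set V} (hFK : ∀ i ∈ s, (F i ∩ K).Nonempty → F i ⊆ K ∪ C) (hKC : Disjoint K C)
    (hA : A ⊆ K ∪ C) (hB : Disjoint K B) (c : ℝ) {p : (∀ v, S v) → ℝ}
    (hp : ∀ ω, p ω = c * ∏ i ∈ s, φ i ω) : CondIndep p A B C := by
  classical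
  intro x y z
  -- `g` gathers the factors that involve `K`, and `f` the others. The event on `A` is attached to
  -- `g`, those on `B` and `C` to `f`; the exchange of second factors is then the required identity.
  let f : (∀ v, S v) → ℝ := fun ω => c * ∏ i ∈ s with ¬ (F i ∩ K).Nonempty, φ i ω
  let g : (∀ v, S v) → ℝ := fun ω => ∏ i ∈ s with (F i ∩ K).Nonempty, φ i ω
  have hfg : ∀ ω, p ω = f ω * g ω := by
    intro ω
    rw [hp, ← Finset.prod_filter_mul_prod_filter_not s fun i => (F i ∩ K).Nonempty]
    simp only [f, g]
    ring
  have hf : ∀ ω ω', (∀ v ∉ K, ω v = ω' v) → f ω = f ω' := by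
    intro ω ω' h
    simp only [f]
    congr 1
    refine Finset.prod_congr rfl fun i hi => ?_
    rw [Finset.mem_filter] at hi
    exact hF i hi.1 _ _ fun v hv => h v fun hvK => hi.2 ⟨v, hv, hvK⟩
  have hg : ∀ ω ω', (∀ v ∈ K ∪ C, ω v = ω' v) → g ω = g ω' := by
    intro ω ω' h
    refine Finset.prod_congr rfl fun i hi => ?_
    rw [Finset.mem_filter] at hi
    exact hF i hi.1 _ _ fun v hv => h v (hFK i hi.1 hi.2 hv)
  have hag : ∀ (U W : Set V) (x ω ω' : ∀ v, S v), U ⊆ W → (∀ v ∈ W, ω v = ω' v) →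
      (ω ∈ agree U x ↔ ω' ∈ agree U x) := by
    intro U W x ω ω' hU h
    exact forall₂_congr fun v hv => by rw [h v (hU hv)]
  have hBK : B ⊆ Kᶜ := fun v hv hK => Set.disjoint_left.1 hB hK hv
  have hCK : C ⊆ Kᶜ := fun v hv hK => Set.disjoint_left.1 hKC hK hv
  have h := sum_mul_sum_exchange hKC z
    (f := (agree B y ∩ agree C z).indicator f) (f' := (agree C z).indicator f)
    (g := (agree A x).indicator g) (g' := g)
    (fun ω ω' h => by
      simp only [Set.indicator, Set.mem_inter_iff, hf ω ω' h, hag B _ y ω ω' hBK h,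
        hag C _ z ω ω' hCK h])
    (fun ω ω' h => by simp only [Set.indicator, hf ω ω' h, hag C _ z ω ω' hCK h])
    (fun ω ω' h => by simp only [Set.indicator, hg ω ω' h, hag A _ x ω ω' hA h])
    hg (fun ω hω => Set.indicator_of_notMem (fun h => hω h.2) _)
    (fun ω hω => Set.indicator_of_notMem hω _)
  have hprob : ∀ U W : Set (∀ v, S v),
      ∑ ω, U.indicator f ω * W.indicator g ω = prob p (W ∩ U) := by
    intro U W
    refine Finset.sum_congr rfl fun ω _ => ?_
    by_cases hU : ω ∈ U <;> by_cases hW : ω ∈ W <;> simp [hU, hW, hfg]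
  have hprob' : ∀ U : Set (∀ v, S v), ∑ ω, U.indicator f ω * g ω = prob p U := by
    intro U
    simpa using hprob U Set.univ
  rw [hprob, hprob, hprob', hprob'] at h
  rw [Set.inter_assoc, h, mul_comm]

/-- `X_A` is not independent from `X_B` given `X_C` if two values of `X_V` that agree on `C` have
positive probability, but not the combination of the first one on `A` and the second one on `B`. -/
theorem not_condIndep {p : (∀ v, S v) → ℝ} (hp : ∀ ω, 0 ≤ p ω) {A B C : Set V} {ω₁ ω₀ : ∀ v, S v}
    (h₁ : p ω₁ ≠ 0) (h₀ : p ω₀ ≠ 0) (hC : ω₁ ∈ agree C ω₀)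
    (h : ∀ ω, p ω ≠ 0 → ω ∈ agree C ω₀ → ω ∈ agree A ω₁ → ω ∉ agree B ω₀) :
    ¬ CondIndep p A B C := by
  intro hi
  have hpos : ∀ (s : Set (∀ v, S v)) (ω : ∀ v, S v), ω ∈ s → p ω ≠ 0 → prob p s ≠ 0 := by
    intro s ω hω hpω
    refine (Finset.sum_pos' (fun ω _ => Set.indicator_nonneg (fun ω _ => hp ω) ω)
      ⟨ω, Finset.mem_univ _, ?_⟩).ne'
    rw [Set.indicator_of_mem hω]
    exact (hp ω).lt_of_ne' hpω
  have h0 : prob p (agree A ω₁ ∩ agree B ω₀ ∩ agree C ω₀) = 0 := by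
    refine Finset.sum_eq_zero fun ω _ => ?_
    by_cases hω : ω ∈ agree A ω₁ ∩ agree B ω₀ ∩ agree C ω₀
    · rw [Set.indicator_of_mem hω]
      by_contra hpω
      exact h ω hpω hω.2 hω.1.1 hω.1.2
    · exact Set.indicator_of_notMem hω _
  have := hi ω₁ ω₀ ω₀
  rw [h0, zero_mul] at this
  exact mul_ne_zero (hpos (agree A ω₁ ∩ agree C ω₀) ω₁ ⟨fun _ _ => rfl, hC⟩ h₁)
    (hpos (agree B ω₀ ∩ agree C ω₀) ω₀ ⟨fun _ _ => rfl, fun _ _ => rfl⟩ h₀) this.symm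

end CondIndep

/-! ### Undirected graphical models -/

section Undirected

variable {V : Type*} [Fintype V] [DecidableEq V] {G : SimpleGraph V} {A B C : Set V}

/-- A clique that meets the set reached from `A` outside `C` lies in the union of this set and `C`:
one more edge extends the walk. -/
theorem Separates.uIndep (h : Separates G A B C) : UIndep G A B C := by
  rintro S _ p - ⟨𝒞, ψ, Z, hcl, -, hp⟩
  rw [separates_iff] at h
  refine condIndep_of_prod 𝒞 (fun K ω => ψ K fun v => ω v) (fun K => K) (fun K _ ω ω' hω => ?_)
    (K := {u | ∃ a ∈ A, Joined G C a u}) (fun K hK hne => ?_) ?_ (fun a ha => ?_) ?_ (1 / Z) hp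
  · exact congrArg (ψ K) (funext fun v => hω v v.2)
  · obtain ⟨u, hu, a, ha, hj⟩ := hne
    intro w hw
    by_cases hwC : w ∈ C
    · exact .inr hwC
    · by_cases huw : u = w
      · exact .inl ⟨a, ha, huw ▸ hj⟩
      · exact .inl ⟨a, ha, hj.tail (hcl K hK hu hw huw) hwC⟩
  · exact Set.disjoint_left.2 fun u ⟨a, _, hj⟩ hu => hj.right_notMem hu
  · by_cases haC : a ∈ C
    · exact .inr haC
    · exact .inl ⟨a, ha, .refl haC⟩
  · exact Set.disjoint_left.2 fun u ⟨a, ha, hj⟩ hu => h a ha u hu hj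

/-- A product of nonnegative functions on cliques that does not vanish identically can be
normalized. -/
theorem exists_uFactorizes {S : V → Type} [∀ v, Fintype (S v)] (𝒞 : Finset (Finset V))
    (ψ : (K : Finset V) → ((v : {v // v ∈ K}) → S v) → ℝ) (h𝒞 : ∀ K ∈ 𝒞, G.IsClique (K : Set V))
    (hψ : ∀ K y, 0 ≤ ψ K y) (ω : ∀ v, S v) (hω : ∀ K ∈ 𝒞, ψ K (fun v => ω v) ≠ 0) :
    ∃ p ∈ stdSimplex ℝ (∀ v, S v), UFactorizes G p ∧
      ∀ x, p x ≠ 0 ↔ ∀ K ∈ 𝒞, ψ K (fun v => x v) ≠ 0 := by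
  have hq : ∀ x : ∀ v, S v, 0 ≤ ∏ K ∈ 𝒞, ψ K fun v => x v :=
    fun x => Finset.prod_nonneg fun K _ => hψ K _
  have hZ : 0 < ∑ x : ∀ v, S v, ∏ K ∈ 𝒞, ψ K fun v => x v :=
    Finset.sum_pos' (fun x _ => hq x)
      ⟨ω, Finset.mem_univ _, (hq ω).lt_of_ne' (Finset.prod_ne_zero_iff.2 hω)⟩
  refine ⟨fun x => 1 / (∑ x : ∀ v, S v, ∏ K ∈ 𝒞, ψ K fun v => x v) * ∏ K ∈ 𝒞, ψ K fun v => x v,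
    ⟨fun x => mul_nonneg (one_div_pos.2 hZ).le (hq x), ?_⟩,
    ⟨𝒞, ψ, _, h𝒞, fun K _ => hψ K, fun x => rfl⟩, fun x => ?_⟩
  · rw [← Finset.mul_sum]
    exact one_div_mul_cancel hZ.ne'
  · rw [← Finset.prod_ne_zero_iff]
    simp only [ne_eq, mul_eq_zero, (one_div_pos.2 hZ).ne', false_or]

/-- Independence in all distributions implies separation: otherwise, if `K` is the set of vertices
joined to `a` by a walk that avoids `C`, consider the uniform distribution on the Boolean families
that vanish outside `K` and are constant on `K`. -/
theorem separates_of_uIndep (h : UIndep G A B C) : Separates G A B C := by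
  classical
  rw [separates_iff]
  intro a ha b hb hj
  let ψ : (K : Finset V) → ((v : {v // v ∈ K}) → Bool) → ℝ := fun K y =>
    if (∀ v : {v // v ∈ K}, ¬ Joined G C a v → y v = false) ∧
      ∀ u v : {v // v ∈ K}, Joined G C a u → Joined G C a v → y u = y v then 1 else 0
  have hψ : ∀ K y, 0 ≤ ψ K y := by
    intro K y
    simp only [ψ]
    split_ifs <;> norm_num
  have hψ1 : ∀ x : V → Bool, (∀ v, ¬ Joined G C a v → x v = false) →
      (∀ u v, Joined G C a u → Joined G C a v → x u = x v) → ∀ K, ψ K (fun v => x v) ≠ 0 := by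
    intro x h1 h2 K
    simp only [ψ]
    rw [if_pos ⟨fun v => h1 v, fun u v => h2 u v⟩]
    exact one_ne_zero
  have h0 := hψ1 (fun _ => false) (fun _ _ => rfl) (fun _ _ _ _ => rfl)
  obtain ⟨p, hp, hpG, hps⟩ := exists_uFactorizes (G := G) (S := fun _ => Bool)
    (Finset.univ.filter fun K => G.IsClique (K : Set V)) ψ (fun K hK => (Finset.mem_filter.1 hK).2)
    hψ (fun _ => false) (fun K _ => h0 K)
  have hab : ∀ x, p x ≠ 0 → x b = x a := by
    intro x hx
    have key : ∀ v, Joined G C a v → x v = x a := by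
      intro v hv
      induction hv with
      | refl _ => rfl
      | @tail u w hu huw hw ih =>
        rw [← ih]
        -- The factor of the edge `{u, w}` forces equal values at its ends.
        have := (hps x).1 hx {u, w} (by simp [huw])
        exact (ite_ne_right_iff.1 this).1.2 ⟨w, by simp⟩ ⟨u, by simp⟩ (hu.tail huw hw) hu
    exact key b hj
  refine not_condIndep hp.1 (ω₁ := fun v => decide (Joined G C a v)) (ω₀ := fun _ => false)
    ((hps _).2 fun K _ => hψ1 (fun v => decide (Joined G C a v)) (fun v hv => by simp [hv])
      (fun u v hu hv => by simp [hu, hv]) K)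
    ((hps _).2 fun K _ => h0 K) (fun v hv => ?_) (fun x hx _ hxA hxB => ?_) (h _ p hp hpG)
  · simp only [decide_eq_false_iff_not]
    exact fun hj => hj.right_notMem hv
  · have h1 := hab x hx
    rw [hxA a ha, hxB b hb] at h1
    simp [Joined.refl hj.left_notMem] at h1

theorem isGraphical_separates (G : SimpleGraph V) :
    IsGraphical (Separates G) (UIndep G) (.mk₂ (fun _ => Set.univ) (fun _ => Set.subset_univ _)
      fun _ _ _ => le_rfl) fun _ => G where
  mono := fun _ _ _ => le_rfl
  sep_iff := fun _ _ _ => Iff.rfl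
  contraction := fun _ _ _ _ => Separates.contraction
  union_left := fun _ _ _ _ => Separates.union_left
  ind_iff := fun _ _ _ => ⟨separates_of_uIndep, Separates.uIndep⟩

end Undirected

end PGM

namespace PGM

/-! ### Directed graphical models: marginals on ascendant closures -/

section Kernel

variable {V : Type*} {G : Digraph V} {S : V → Type}

/-- Weights of the values of each variable, depending on the values of its parents. -/
abbrev Kernel (G : Digraph V) (S : V → Type) : Type _ :=
  (v : V) → S v → ((u : {u // G.Adj u v}) → S u) → ℝ

/-- The product of the values of a kernel. -/
def Kernel.joint [Fintype V] (k : Kernel G S) (x : ∀ v, S v) : ℝ :=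
  ∏ v, k v (x v) fun u => x u

theorem IsAcyclic.exists_source [Finite V] (hG : IsAcyclic G) {U : Set V} (hU : U.Nonempty) :
    ∃ v ∈ U, ∀ u ∈ U, ¬ G.Adj u v := by
  have : Std.Irrefl (Relation.TransGen G.Adj) := ⟨hG⟩
  obtain ⟨v, hv, h⟩ := (Finite.wellFounded_of_trans_of_irrefl (Relation.TransGen G.Adj)).has_min U hU
  exact ⟨v, hv, fun u hu ha => h u hu (.single ha)⟩

variable [Fintype V] [DecidableEq V] [∀ v, Fintype (S v)]

/-- Two factors of total mass one as functions of one variable can be exchanged. -/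
theorem sum_mul_eq_sum_mul (v : V) (f : (∀ v, S v) → ℝ) (g g' : S v → (∀ v, S v) → ℝ)
    (hf : ∀ x a, f (Function.update x v a) = f x)
    (hg : ∀ a x b, g a (Function.update x v b) = g a x)
    (hg' : ∀ a x b, g' a (Function.update x v b) = g' a x)
    (h1 : ∀ x, ∑ a, g a x = 1) (h1' : ∀ x, ∑ a, g' a x = 1) :
    ∑ x, f x * g (x v) x = ∑ x, f x * g' (x v) x := by
  -- An auxiliary value of `X_v`, swapped with the actual one, allows `g` to be summed to one. The
  -- resulting factor `Fintype.card (S v)` is cancelled at the end.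
  have key : ∀ g : S v → (∀ v, S v) → ℝ, (∀ a x b, g a (Function.update x v b) = g a x) →
      (∀ x, ∑ a, g a x = 1) → ∑ q : S v × (∀ v, S v), f q.2 * g (q.2 v) q.2 = ∑ x, f x := by
    intro g hg h1
    let e : S v × (∀ v, S v) ≃ S v × (∀ v, S v) :=
      Function.Involutive.toPerm (fun q => (q.2 v, Function.update q.2 v q.1)) (by
        rintro ⟨a, x⟩
        simp)
    rw [← Equiv.sum_comp e, Fintype.sum_prod_type_right]
    refine Finset.sum_congr rfl fun x _ => ?_
    rw [← mul_one (f x), ← h1 x, Finset.mul_sum]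
    refine Finset.sum_congr rfl fun a _ => ?_
    change f (Function.update x v a) * g (Function.update x v a v) (Function.update x v a) = _
    rw [Function.update_self, hf, hg]
  rcases isEmpty_or_nonempty (S v) with he | he
  · have : IsEmpty (∀ v, S v) := ⟨fun x => he.false (x v)⟩
    simp
  · have h := (key g hg h1).trans (key g' hg' h1').symm
    simp only [Fintype.sum_prod_type, Finset.sum_const, Finset.card_univ] at h
    exact smul_right_injective ℝ (Fintype.card_ne_zero (α := S v)) h

/-- The sum of a function of the variables outside `U`, where `U` contains the descendants of its
elements, does not depend on the kernel at the elements of `U`. -/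
theorem sum_mul_joint_congr (hG : IsAcyclic G) (k k' : Kernel G S)
    (hk : ∀ v y, ∑ a, k v a y = 1) (hk' : ∀ v a y y', k' v a y = k' v a y')
    (hk1 : ∀ v y, ∑ a, k' v a y = 1)
    (U : Finset V) (hU : ∀ u ∈ U, ∀ v, G.Adj u v → v ∈ U) (f : (∀ v, S v) → ℝ)
    (hf : ∀ x, ∀ v ∈ U, ∀ a, f (Function.update x v a) = f x) :
    ∑ x, f x * k.joint x =
      ∑ x, f x * Kernel.joint (G := G) (fun v => if v ∈ U then k' v else k v) x := by
  induction hn : U.card generalizing U with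
  | zero =>
    obtain rfl := Finset.card_eq_zero.1 hn
    simp
  | succ n ih =>
    -- Without its source `v`, the set `U` is still closed under children. Once its other elements
    -- have kernels `k'`, which ignore parents, `X_v` occurs in the factor of `v` only, as all
    -- children of `v` are in `U`.
    obtain ⟨v, hv, hsrc⟩ := hG.exists_source (U := U) (Finset.card_pos.1 (by omega))
    rw [Finset.mem_coe] at hv
    rw [ih (U.erase v)
      (fun u hu w ha => Finset.mem_erase.2 ⟨?_, hU u (Finset.mem_of_mem_erase hu) w ha⟩)
      (fun x w hw => hf x w (Finset.mem_of_mem_erase hw))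
      (by rw [Finset.card_erase_of_mem hv, hn]; rfl)]
    swap
    · rintro rfl
      exact hsrc u (Finset.mem_of_mem_erase hu) ha
    have split : ∀ k'' : Kernel G S, ∀ x, f x * k''.joint x =
        f x * (∏ w ∈ Finset.univ.erase v, k'' w (x w) fun u => x u) * k'' v (x v) fun u => x u := by
      intro k'' x
      rw [mul_assoc, Finset.prod_erase_mul _ _ (Finset.mem_univ v)]
      rfl
    have hrest : ∀ x : ∀ v, S v, (∏ w ∈ Finset.univ.erase v,
          (if w ∈ U.erase v then k' w else k w) (x w) fun u => x u) =
        ∏ w ∈ Finset.univ.erase v, (if w ∈ U then k' w else k w) (x w) fun u => x u := by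
      intro x
      refine Finset.prod_congr rfl fun w hw => ?_
      simp [Finset.ne_of_mem_erase hw]
    have hpar : ∀ w, w ≠ v → ∀ x a,
        (if w ∈ U then k' w else k w) (Function.update x v a w)
          (fun u => Function.update x v a u) =
        (if w ∈ U then k' w else k w) (x w) fun u => x u := by
      intro w hw x a
      rw [Function.update_of_ne hw]
      split_ifs with hwU
      · exact hk' _ _ _ _
      · congr 1
        funext u
        refine Function.update_of_ne ?_ _ _
        rintro hu
        exact hwU (hU v hv w (hu ▸ u.2))
    have hloop : ∀ (x : ∀ v, S v) b, (fun u : {u // G.Adj u v} => Function.update x v b u) =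
        fun u : {u // G.Adj u v} => x u := by
      intro x b
      funext u
      refine Function.update_of_ne ?_ _ _
      intro hu
      have := u.2
      rw [hu] at this
      exact hG v (.single this)
    simp only [split, hrest, Finset.notMem_erase, if_false, if_pos hv]
    refine sum_mul_eq_sum_mul v
      (fun x => f x * ∏ w ∈ Finset.univ.erase v, (if w ∈ U then k' w else k w) (x w) fun u => x u)
      (fun a x => k v a fun u => x u) (fun a x => k' v a fun u => x u) (fun x a => ?_)
      (fun a x b => by rw [hloop]) (fun a x b => by rw [hloop]) (fun x => hk _ _) (fun x => hk1 _ _)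
    rw [hf x v hv a]
    congr 1
    exact Finset.prod_congr rfl fun w hw => hpar w (Finset.ne_of_mem_erase hw) x a

/-- Kernels frozen at the parent values of `ω` make the variables independent without changing the
total mass. -/
theorem sum_joint (hG : IsAcyclic G) (k : Kernel G S) (hk : ∀ v y, ∑ a, k v a y = 1)
    (ω : ∀ v, S v) : ∑ x, k.joint x = 1 := by
  have := sum_mul_joint_congr hG k (fun v a _ => k v a fun u => ω u) hk (fun _ _ _ _ => rfl)
    (fun v _ => hk v _) Finset.univ (fun _ _ _ _ => Finset.mem_univ _) (fun _ => 1)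
    (fun _ _ _ _ => rfl)
  simp only [one_mul, Finset.mem_univ, if_true] at this
  rw [this]
  simp only [Kernel.joint]
  refine (Fintype.prod_sum fun v a => k v a fun u => ω u).symm.trans ?_
  exact Finset.prod_eq_one fun v _ => hk v _

/-- Outside the ascendant closure `W`, kernels can be made to ignore parents without changing the
law of `X_W`. The other factors live on families of vertices of `W`, which are cliques of the moral
graph. -/
theorem DSeparates.dIndep (hG : IsAcyclic G) {A B C : Set V} (h : DSeparates G A B C) :
    DIndep G A B C := by
  classical
  rintro S _ p hp ⟨k, hk, hpk⟩
  have hk1 : ∀ v y, ∑ a, k v a y = 1 := fun v y => (hk v y).2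
  obtain ⟨ω⟩ : Nonempty (∀ v, S v) := by
    by_contra hne
    rw [not_nonempty_iff] at hne
    simpa using hp.2
  set W := ascClosure G (A ∪ B ∪ C)
  have hsub : A ∪ B ∪ C ⊆ W := subset_ascClosure
  let k' : Kernel G S := fun v a _ => k v a fun u => ω u
  let U : Finset V := Finset.univ.filter fun v => v ∉ W
  let l : Kernel G S := fun v => if v ∈ U then k' v else k v
  have hprob : ∀ s : Set (∀ v, S v), (∀ x y : ∀ v, S v, (∀ v ∈ W, x v = y v) → (x ∈ s ↔ y ∈ s)) →
      prob p s = prob l.joint s := by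
    intro s hs
    have := sum_mul_joint_congr hG k k' hk1 (fun _ _ _ _ => rfl) (fun v _ => hk1 v _) U
      (fun u hu v ha => by
        simp only [U, Finset.mem_filter, Finset.mem_univ, true_and] at hu ⊢
        exact fun hv => hu (mem_ascClosure_of_adj ha hv)) (s.indicator 1)
      (fun x v hv a => by
        have hvW : v ∉ W := by simpa [U] using hv
        have : Function.update x v a ∈ s ↔ x ∈ s := hs _ _ fun w hw =>
          Function.update_of_ne (by rintro rfl; exact hvW hw) _ _
        simp only [Set.indicator, this, Pi.one_apply])
    have hpk' : p = Kernel.joint (G := G) k := funext hpk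
    rw [hpk']
    simpa [prob, Set.indicator_apply] using this
  have hag : ∀ (Y : Set V) (z x y : ∀ v, S v), Y ⊆ W → (∀ v ∈ W, x v = y v) →
      (x ∈ agree Y z ↔ y ∈ agree Y z) := by
    intro Y z x y hY h
    exact forall₂_congr fun v hv => by rw [h v (hY hv)]
  have hA : A ⊆ W := fun v hv => hsub (.inl (.inl hv))
  have hB : B ⊆ W := fun v hv => hsub (.inl (.inr hv))
  have hC : C ⊆ W := fun v hv => hsub (.inr hv)
  have hl : CondIndep l.joint A B C := by
    rw [dSeparates_iff_separates hG, separates_iff] at h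
    refine condIndep_of_prod Finset.univ (fun v x => l v (x v) fun u => x u)
      (fun v => {u | u = v ∨ v ∈ W ∧ G.Adj u v}) (fun v _ x y hxy => ?_)
      (K := {u | ∃ a ∈ A, Joined (moralGraph G W) C a u}) (fun v _ hne => ?_) ?_ (fun a ha => ?_) ?_
      1 (fun x => (one_mul _).symm)
    · simp only [l]
      rw [hxy v (.inl rfl)]
      split_ifs with hv
      · rfl
      · congr 1
        funext u
        exact hxy u (.inr ⟨by simpa [U] using hv, u.2⟩)
    · obtain ⟨u, hu, a, ha, hj⟩ := hne
      intro w hw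
      by_cases hwC : w ∈ C
      · exact .inr hwC
      · by_cases huw : u = w
        · exact .inl ⟨a, ha, huw ▸ hj⟩
        · refine .inl ⟨a, ha, hj.tail ⟨huw, v, ?_, hu.imp_right And.right, hw.imp_right And.right⟩
            hwC⟩
          rcases hu with rfl | hu
          · rcases hw with rfl | hw
            · exact (huw rfl).elim
            · exact hw.1
          · exact hu.1
    · exact Set.disjoint_left.2 fun u ⟨a, _, hj⟩ hu => hj.right_notMem hu
    · by_cases haC : a ∈ C
      · exact .inr haC
      · exact .inl ⟨a, ha, .refl haC⟩
    · exact Set.disjoint_left.2 fun u ⟨a, ha, hj⟩ hu => h a ha u hu hj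
  intro x y z
  rw [hprob, hprob, hprob, hprob]
  · exact hl x y z
  all_goals
    intro u v huv
    simp only [Set.mem_inter_iff, hag A _ u v hA huv, hag B _ u v hB huv, hag C _ u v hC huv]

end Kernel

end PGM

namespace PGM

/-! ### Directed graphical models: dependence along active trails -/

section Model

variable {V : Type*} {G : Digraph V}

/-- The possible values of each variable given the values of its parents. -/
structure Model (G : Digraph V) where
  /-- The values of the variables. -/
  S : V → Type
  /-- There are finitely many values. -/
  fin : ∀ v, Fintype (S v)
  /-- The value of a variable is possible given the values of its parents. -/
  T : (v : V) → S v → ((u : {u // G.Adj u v}) → S u) → Prop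
  total : ∀ v y, ∃ a, T v a y

namespace Model

/-- All the values are possible given those of the parents. -/
def Supp (m : Model G) (x : ∀ v, m.S v) : Prop :=
  ∀ v, m.T v (x v) fun u => x u

/-- The distribution with uniform conditional distributions on the possible values. -/
theorem exists_dFactorizes [Fintype V] [DecidableEq V] (hG : IsAcyclic G) (m : Model G)
    (ω : ∀ v, m.S v) :
    let _ := m.fin
    ∃ p ∈ stdSimplex ℝ (∀ v, m.S v), DFactorizes G p ∧ ∀ x, p x ≠ 0 ↔ m.Supp x := by
  classical
  let _ := m.fin
  let k : Kernel G m.S := fun v a y =>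
    if m.T v a y then ((Finset.univ.filter fun b => m.T v b y).card : ℝ)⁻¹ else 0
  have hpos : ∀ v y, ((Finset.univ.filter fun b => m.T v b y).card : ℝ) ≠ 0 := by
    intro v y
    obtain ⟨a, ha⟩ := m.total v y
    exact Nat.cast_ne_zero.2 (Finset.card_ne_zero.2 ⟨a, by simpa using ha⟩)
  have hk0 : ∀ v a y, 0 ≤ k v a y := by
    intro v a y
    simp only [k]
    split_ifs <;> positivity
  have hk1 : ∀ v y, ∑ a, k v a y = 1 := by
    intro v y
    simp only [k]
    rw [← Finset.sum_filter, Finset.sum_const, nsmul_eq_mul, mul_inv_cancel₀ (hpos v y)]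
  refine ⟨k.joint, ⟨fun x => Finset.prod_nonneg fun v _ => hk0 _ _ _, sum_joint hG k hk1 ω⟩,
    ⟨k, fun v y => ⟨fun a => hk0 v a y, hk1 v y⟩, fun x => rfl⟩, fun x => ?_⟩
  rw [Kernel.joint, Finset.prod_ne_zero_iff]
  simp [k, Supp, hpos]

/-- `m'` refines `m` by means of the maps `π v`. -/
structure IsRefinement (m m' : Model G) (π : ∀ v, m'.S v → m.S v) : Prop where
  proj : ∀ v a y, m'.T v a y → m.T v (π v a) fun u => π u (y u)
  lift : ∀ v a (y : (u : {u // G.Adj u v}) → m'.S u), m.T v a (fun u => π u (y u)) →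
    ∃ a', π v a' = a ∧ m'.T v a' y

theorem IsRefinement.supp {m m' : Model G} {π : ∀ v, m'.S v → m.S v} (h : IsRefinement m m' π)
    {x : ∀ v, m'.S v} (hx : m'.Supp x) : m.Supp fun v => π v (x v) :=
  fun v => h.proj v _ _ (hx v)

theorem IsRefinement.refl (m : Model G) : IsRefinement m m fun _ a => a where
  proj := fun _ _ _ h => h
  lift := fun _ a _ h => ⟨a, rfl, h⟩

theorem IsRefinement.trans {m m' m'' : Model G} {π : ∀ v, m'.S v → m.S v}
    {π' : ∀ v, m''.S v → m'.S v} (h : IsRefinement m m' π) (h' : IsRefinement m' m'' π') :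
    IsRefinement m m'' fun v a => π v (π' v a) where
  proj := fun v a y ha => h.proj v _ _ (h'.proj v a y ha)
  lift := fun v a y ha => by
    obtain ⟨b, rfl, hb⟩ := h.lift v a (fun u => π' u (y u)) ha
    obtain ⟨c, rfl, hc⟩ := h'.lift v b y hb
    exact ⟨c, rfl, hc⟩

/-- Add to each variable a Boolean function of its parents. -/
def adjoin (m : Model G) (F : (v : V) → ((u : {u // G.Adj u v}) → m.S u) → Bool) : Model G where
  S v := m.S v × Bool
  fin v := letI := m.fin v; inferInstance
  T v a y := m.T v a.1 (fun u => (y u).1) ∧ a.2 = F v fun u => (y u).1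
  total v y := by
    obtain ⟨a, ha⟩ := m.total v fun u => (y u).1
    exact ⟨(a, _), ha, rfl⟩

theorem isRefinement_adjoin (m : Model G)
    (F : (v : V) → ((u : {u // G.Adj u v}) → m.S u) → Bool) :
    IsRefinement m (m.adjoin F) fun _ a => a.1 where
  proj := fun _ _ _ h => h.1
  lift := fun _ a _ h => ⟨(a, _), rfl, h, rfl⟩

/-- If the bit `g` of `X_w` vanishes for `ω₀` and `ω₁`, and if `w` has a descendant in `Z`, then
a refinement of the model makes observable in `X_Z` that this bit vanishes. -/
theorem exists_refinement_test {Z : Set V} {w z : V} (hwz : Relation.ReflTransGen G.Adj w z)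
    (hz : z ∈ Z) (m : Model G) (ω₀ ω₁ : ∀ v, m.S v) (h₀ : m.Supp ω₀) (h₁ : m.Supp ω₁)
    (hZ : ω₁ ∈ agree Z ω₀) (g : m.S w → Bool) (hg₀ : g (ω₀ w) = false) (hg₁ : g (ω₁ w) = false) :
    ∃ (m' : Model G) (π : ∀ v, m'.S v → m.S v) (ω₀' ω₁' : ∀ v, m'.S v),
      IsRefinement m m' π ∧ m'.Supp ω₀' ∧ m'.Supp ω₁' ∧ ω₁' ∈ agree Z ω₀' ∧
      (∀ v, π v (ω₀' v) = ω₀ v) ∧ (∀ v, π v (ω₁' v) = ω₁ v) ∧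
      ∀ ω, m'.Supp ω → ω ∈ agree Z ω₀' → g (π w (ω w)) = false := by
  classical
  induction hwz using Relation.ReflTransGen.head_induction_on generalizing m with
  | refl =>
    exact ⟨m, fun _ a => a, ω₀, ω₁, .refl m, h₀, h₁, hZ, fun _ => rfl, fun _ => rfl,
      fun ω _ hω => by rw [hω z hz, hg₀]⟩
  | @head w c ha _ ih =>
    -- The child `c` on the path to `z` copies the bit, and the induction tests the copy.
    let F : (v : V) → ((u : {u // G.Adj u v}) → m.S u) → Bool := fun v y =>
      if h : v = c ∧ G.Adj w v then g (y ⟨w, h.2⟩) else false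
    have hF : ∀ x : ∀ v, m.S v, g (x w) = false → ∀ v, F v (fun u => x u) = false := by
      intro x hx v
      simp only [F]
      split_ifs
      · exact hx
      · rfl
    obtain ⟨m', π, ω₀', ω₁', href, h₀', h₁', hZ', hπ₀, hπ₁, htest⟩ := ih (m.adjoin F)
      (fun v => (ω₀ v, false)) (fun v => (ω₁ v, false)) (fun v => ⟨h₀ v, (hF ω₀ hg₀ v).symm⟩)
      (fun v => ⟨h₁ v, (hF ω₁ hg₁ v).symm⟩) (fun v hv => congrArg (fun a => (a, false)) (hZ v hv))
      (fun a => a.2)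
      rfl rfl
    refine ⟨m', fun v a => (π v a).1, ω₀', ω₁', (m.isRefinement_adjoin F).trans href, h₀', h₁', hZ',
      fun v => congrArg Prod.fst (hπ₀ v), fun v => congrArg Prod.fst (hπ₁ v), fun ω hω hωZ => ?_⟩
    have h1 := (htest ω hω hωZ).symm.trans (href.supp hω c).2
    exact (h1.trans (dif_pos ⟨rfl, ha⟩)).symm

/-- The bit `g` of `X_u` is false for `ω₀`, is true for `ω₁`, and is true whenever `X_x` is as in
`ω₁` and `X_Z` is as in `ω₀` and in `ω₁`. -/
structure Signals (m : Model G) (Z : Set V) (x u : V) (ω₀ ω₁ : ∀ v, m.S v) (g : m.S u → Bool) :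
    Prop where
  supp₀ : m.Supp ω₀
  supp₁ : m.Supp ω₁
  agree : ω₁ ∈ agree Z ω₀
  eq₀ : g (ω₀ u) = false
  eq₁ : g (ω₁ u) = true
  eq : ∀ ω, m.Supp ω → ω ∈ PGM.agree Z ω₀ → ω x = ω₁ x → g (ω u) = true

/-- The bit `g` of `X_u` takes both values whatever the values of the parents of `u`. -/
def IsFree (m : Model G) {u : V} (g : m.S u → Bool) : Prop :=
  ∀ y β, ∃ a, m.T u a y ∧ g a = β

end Model

open Model

/-- Some model transmits a bit from `X` to `u` given `Z`. -/
def Transmits (G : Digraph V) (X Z : Set V) (u : V) : Prop :=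
  ∃ x ∈ X, ∃ (m : Model G) (ω₀ ω₁ : ∀ v, m.S v) (g : m.S u → Bool), m.Signals Z x u ω₀ ω₁ g

/-- Some model transmits a bit from `X` to `u` given `Z` that does not depend on the parents of
`u`. -/
def TransmitsFree (G : Digraph V) (X Z : Set V) (u : V) : Prop :=
  ∃ x ∈ X, ∃ (m : Model G) (ω₀ ω₁ : ∀ v, m.S v) (g : m.S u → Bool),
    m.Signals Z x u ω₀ ω₁ g ∧ m.IsFree g

theorem TransmitsFree.transmits {X Z : Set V} {u : V} (h : TransmitsFree G X Z u) :
    Transmits G X Z u := by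
  obtain ⟨x, hx, m, ω₀, ω₁, g, h, -⟩ := h
  exact ⟨x, hx, m, ω₀, ω₁, g, h⟩

theorem transmitsFree_of_mem {X Z : Set V} {x : V} (hx : x ∈ X) (hxZ : x ∉ Z) :
    TransmitsFree G X Z x := by
  classical
  let m : Model G :=
    { S := fun _ => Bool
      fin := fun _ => inferInstance
      T := fun v a _ => v = x ∨ a = false
      total := fun _ _ => ⟨false, .inr rfl⟩ }
  refine ⟨x, hx, m, fun _ => false, fun v => decide (v = x), id,
    ⟨fun v => .inr rfl, fun v => ?_, fun v hv => ?_, rfl, by simp, fun ω _ _ h => ?_⟩,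
    fun y β => ⟨β, .inl rfl, rfl⟩⟩
  · by_cases hv : v = x
    · exact .inl hv
    · exact .inr (by simp [hv])
  · exact decide_eq_false (by rintro rfl; exact hxZ hv)
  · simpa using h

/-- `w` copies the bit of `u`, which is invisible in `X_Z` since `w ∉ Z`. -/
theorem Transmits.down {X Z : Set V} {u w : V} (h : Transmits G X Z u) (ha : G.Adj u w)
    (hw : w ∉ Z) : Transmits G X Z w := by
  classical
  obtain ⟨x, hx, m, ω₀, ω₁, g, h⟩ := h
  let F : (v : V) → ((u : {u // G.Adj u v}) → m.S u) → Bool := fun v y =>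
    if h : v = w ∧ G.Adj u v then g (y ⟨u, h.2⟩) else false
  have hFw : ∀ y, F w y = g (y ⟨u, ha⟩) := fun y => dif_pos ⟨rfl, ha⟩
  have hF : ∀ v y, v ≠ w → F v y = false := fun v y hv => dif_neg fun h => hv h.1
  refine ⟨x, hx, m.adjoin F, fun v => (ω₀ v, F v fun u => ω₀ u), fun v => (ω₁ v, F v fun u => ω₁ u),
    fun a => a.2, fun v => ⟨h.supp₀ v, rfl⟩, fun v => ⟨h.supp₁ v, rfl⟩, fun v hv => ?_, ?_, ?_,
    fun ω hω hωZ hωx => ?_⟩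
  · have hvw : v ≠ w := by
      rintro rfl
      exact hw hv
    exact Prod.ext (h.agree v hv) ((hF v (fun u => ω₁ u) hvw).trans (hF v (fun u => ω₀ u) hvw).symm)
  · simp only [hFw, h.eq₀]
  · simp only [hFw, h.eq₁]
  · refine ((hω w).2.trans (hFw fun u => (ω u).1)).trans ?_
    exact h.eq (fun v => (ω v).1) (fun v => (hω v).1) (fun v hv => congrArg Prod.fst (hωZ v hv))
      (congrArg Prod.fst hωx)

/-- Against the arc, `w` draws an arbitrary bit and `u` is constrained to have an equal one. This is
always possible because the bit of `u` is free, and the bit of `w` is free in turn. -/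
theorem TransmitsFree.up (hG : IsAcyclic G) {X Z : Set V} {u w : V} (h : TransmitsFree G X Z u)
    (ha : G.Adj w u) (hw : w ∉ Z) : TransmitsFree G X Z w := by
  classical
  obtain ⟨x, hx, m, ω₀, ω₁, g, h, hfree⟩ := h
  have hwu : w ≠ u := by
    rintro rfl
    exact hG w (.single ha)
  let m' : Model G :=
    { S := fun v => m.S v × Bool
      fin := fun v => letI := m.fin v; inferInstance
      T := fun v a y => m.T v a.1 (fun u => (y u).1) ∧ (v ≠ w → a.2 = false) ∧
        ∀ (h : v = u) (h' : G.Adj w v), g (h ▸ a.1) = (y ⟨w, h'⟩).2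
      total := fun v y => by
        by_cases hv : v = u
        · subst hv
          obtain ⟨a, ha1, ha2⟩ := hfree (fun u => (y u).1) (y ⟨w, ha⟩).2
          exact ⟨(a, false), ha1, fun _ => rfl, fun _ _ => ha2⟩
        · obtain ⟨a, ha⟩ := m.total v fun u => (y u).1
          exact ⟨(a, false), ha, fun _ => rfl, fun h => absurd h hv⟩ }
  refine ⟨x, hx, m', fun v => (ω₀ v, false), fun v => (ω₁ v, decide (v = w)), fun a => a.2,
    ⟨fun v => ⟨h.supp₀ v, fun _ => rfl, ?_⟩,
      fun v => ⟨h.supp₁ v, fun hv => decide_eq_false hv, ?_⟩, fun v hv => ?_, rfl, by simp,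
      fun ω hω hωZ hωx => ?_⟩, fun y β => ?_⟩
  · rintro rfl _
    exact h.eq₀
  · rintro rfl _
    simpa using h.eq₁
  · have hvw : v ≠ w := by
      rintro rfl
      exact hw hv
    simp only [h.agree v hv, hvw, decide_false]
  · rw [← (hω u).2.2 rfl ha]
    exact h.eq (fun v => (ω v).1) (fun v => (hω v).1) (fun v hv => congrArg Prod.fst (hωZ v hv))
      (congrArg Prod.fst hωx)
  · obtain ⟨a, ha⟩ := m.total w fun u => (y u).1
    exact ⟨(a, β), ⟨ha, fun h => (h rfl).elim, fun h => absurd h hwu⟩, rfl⟩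

/-- `v` draws a free bit and `w` records its exclusive or with the bit of `u`. Testing through a
descendant of `w` in `Z` that this is false forces the two bits to be equal. -/
theorem Transmits.collide {X Z : Set V} {u v w : V} (h : Transmits G X Z u) (hu : G.Adj u w)
    (hv : G.Adj v w) (hvZ : v ∉ Z) (hne : (dscClosure G w ∩ Z).Nonempty) :
    TransmitsFree G X Z v := by
  classical
  obtain ⟨x, hx, m, ω₀, ω₁, g, h⟩ := h
  obtain ⟨z, hwz, hz⟩ := hne
  let m₁ : Model G :=
    { S := fun t => m.S t × Bool
      fin := fun t => letI := m.fin t; inferInstance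
      T := fun t a y => m.T t a.1 (fun u => (y u).1) ∧ (t ≠ v → a.2 = false)
      total := fun t y => by
        obtain ⟨a, ha⟩ := m.total t fun u => (y u).1
        exact ⟨(a, false), ha, fun _ => rfl⟩ }
  let F : (t : V) → ((u : {u // G.Adj u t}) → m₁.S u) → Bool := fun t y =>
    if h : t = w ∧ G.Adj u t ∧ G.Adj v t then
      xor (g (y ⟨u, h.2.1⟩).1) (y ⟨v, h.2.2⟩).2 else false
  have hFw : ∀ y, F w y = xor (g (y ⟨u, hu⟩).1) (y ⟨v, hv⟩).2 := fun y => dif_pos ⟨rfl, hu, hv⟩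
  have hF : ∀ t y, t ≠ w → F t y = false := fun t y ht => dif_neg fun h => ht h.1
  have hF0 : ∀ x : ∀ t, m₁.S t, g (x u).1 = (x v).2 → ∀ t, false = F t fun u => x u := by
    intro x hx t
    by_cases ht : t = w
    · subst ht
      exact ((hFw fun u => x u).trans ((congrArg (xor · _) hx).trans (Bool.xor_self _))).symm
    · exact (hF t (fun u => x u) ht).symm
  obtain ⟨m', π, ω₀', ω₁', href, h₀', h₁', hZ', hπ₀, hπ₁, htest⟩ :=
    exists_refinement_test hwz hz (m₁.adjoin F) (fun t => ((ω₀ t, false), false))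
      (fun t => ((ω₁ t, decide (t = v)), false))
      (fun t => ⟨⟨h.supp₀ t, fun _ => rfl⟩, hF0 (fun t => (ω₀ t, false)) h.eq₀ t⟩)
      (fun t => ⟨⟨h.supp₁ t, fun ht => decide_eq_false ht⟩,
        hF0 (fun t => (ω₁ t, decide (t = v))) (by simpa using h.eq₁) t⟩)
      (fun t ht => by
        have htv : t ≠ v := by
          rintro rfl
          exact hvZ ht
        exact Prod.ext (Prod.ext (h.agree t ht) (decide_eq_false htv)) rfl)
      (fun a => a.2) rfl rfl
  refine ⟨x, hx, m', ω₀', ω₁', fun a => (π v a).1.2, ⟨h₀', h₁', hZ', by rw [hπ₀], by simp [hπ₁],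
    fun ω hω hωZ hωx => ?_⟩, fun y β => ?_⟩
  · have h1 := href.supp hω
    have h2 := (htest ω hω hωZ).symm.trans ((h1 w).2.trans (hFw fun u => (π u (ω u)).1))
    have h3 := h.eq (fun t => (π t (ω t)).1.1) (fun t => (h1 t).1.1)
      (fun t ht => congrArg (fun a => a.1.1) ((congrArg (π t) (hωZ t ht)).trans (hπ₀ t)))
      (congrArg (fun a => a.1.1) ((congrArg (π x) hωx).trans (hπ₁ x)))
    have h4 : false = xor true (π v (ω v)).1.2 := h2.trans (congrArg (xor · _) h3)
    simpa using h4
  · obtain ⟨a, ha⟩ := m.total v fun u => (π u (y u)).1.1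
    obtain ⟨b, hb, hb'⟩ := (m₁.isRefinement_adjoin F).lift v (a, β) (fun u => π u (y u))
      ⟨ha, fun h => (h rfl).elim⟩
    obtain ⟨c, hc, hc'⟩ := href.lift v b y hb'
    exact ⟨c, hc', (congrArg (fun a => a.1.2) hc).trans (congrArg Prod.snd hb)⟩

/-- After an arc into `u` the bit is kept at the parent: `u` may be a v-structure in `Z`, and a
copied bit would not be free. -/
theorem Reach.transmits (hG : IsAcyclic G) {X Z : Set V} {u : V} {d : Bool}
    (h : Reach G X Z u d) :
    (d = false → TransmitsFree G X Z u) ∧ (d = true → ∃ w, G.Adj w u ∧ Transmits G X Z w) := by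
  induction h with
  | start hx hxZ => exact ⟨fun _ => transmitsFree_of_mem hx hxZ, by simp⟩
  | @down u w d _ hu ha ih =>
    refine ⟨by simp, fun _ => ⟨u, ha, ?_⟩⟩
    cases d with
    | false => exact (ih.1 rfl).transmits
    | true =>
      obtain ⟨t, hta, ht⟩ := ih.2 rfl
      exact ht.down hta hu
  | up _ ha hw ih => exact ⟨fun _ => (ih.1 rfl).up hG ha hw, by simp⟩
  | collide _ hne ha hw ih =>
    obtain ⟨t, hta, ht⟩ := ih.2 rfl
    exact ⟨fun _ => ht.collide hta ha hw hne, by simp⟩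

/-- Given the common value on `C`, the value `ω₁ a` forces a true bit at `b`, where `ω₀` has a false
one. -/
theorem dSeparates_of_dIndep [Fintype V] [DecidableEq V] (hG : IsAcyclic G) {A B C : Set V}
    (h : DIndep G A B C) : DSeparates G A B C := by
  rw [dSeparates_iff hG]
  intro b hb d hr
  by_contra hbC
  obtain ⟨a, ha, m, ω₀, ω₁, g, hs⟩ : Transmits G A C b := by
    cases d with
    | false => exact ((hr.transmits hG).1 rfl).transmits
    | true =>
      obtain ⟨w, hw, ht⟩ := (hr.transmits hG).2 rfl
      exact ht.down hw hbC
  let _ := m.fin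
  obtain ⟨p, hp, hpG, hps⟩ := m.exists_dFactorizes hG ω₀
  refine not_condIndep hp.1 ((hps _).2 hs.supp₁) ((hps _).2 hs.supp₀) hs.agree
    (fun ω hω hωC hωA hωB => ?_) (h _ p hp hpG)
  have h1 := hs.eq ω ((hps _).1 hω) hωC (hωA a ha)
  rw [hωB b hb, hs.eq₀] at h1
  exact Bool.false_ne_true h1

theorem isGraphical_dSeparates [Fintype V] [DecidableEq V] (hG : IsAcyclic G) :
    IsGraphical (DSeparates G) (DIndep G) (ascClosureOperator G) (moralGraph G) where
  mono := moralGraph_mono G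
  sep_iff := fun _ _ _ => dSeparates_iff_separates hG
  contraction := fun _ _ _ _ => DSeparates.contraction hG
  union_left := fun _ _ _ _ => DSeparates.union_left
  ind_iff := fun _ _ _ => ⟨dSeparates_of_dIndep hG, DSeparates.dIndep hG⟩

end Model

end PGM

theorem mainTheorem4 {V : Type*} [Fintype V] [DecidableEq V] :
    (∀ (G : SimpleGraph V) (B D E M : Set V),
      M ∩ (B ∪ D) ⊆ E →
      PGM.IsSeparator (PGM.Separates G) B D E M →
      ∃ M' M₁ : Set V,
        PGM.IsMarkovBlanketIn (PGM.UIndep G) M B E M' ∧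
        PGM.IsMarkovBlanketIn (PGM.UIndep G) M' D E M₁ ∧
        PGM.IsNearestSeparator (PGM.Separates G) B D E M M₁ ∧
        ∀ N : Set V, N ⊆ M → PGM.IsNearestSeparator (PGM.Separates G) B D E M N → N = M₁) ∧
    (∀ (G : Digraph V) (B D E M : Set V),
      PGM.IsAcyclic G →
      M ∩ (B ∪ D) ⊆ E →
      PGM.IsSeparator (PGM.DSeparates G) B D E M →
      M ⊆ PGM.ascClosure G (B ∪ D ∪ E) →
      ∃ M' M₁ : Set V,
        PGM.IsMarkovBlanketIn (PGM.DIndep G) M B E M' ∧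
        PGM.IsMarkovBlanketIn (PGM.DIndep G) M' D E M₁ ∧
        PGM.IsNearestSeparator (PGM.DSeparates G) B D E M M₁ ∧
        ∀ N : Set V, N ⊆ M → PGM.IsNearestSeparator (PGM.DSeparates G) B D E M N → N = M₁) :=
  ⟨fun G _ _ _ _ hM hsep =>
      (PGM.isGraphical_separates G).exists_nearest hM hsep (Set.subset_univ _),
    fun _ _ _ _ _ hG hM hsep hA => (PGM.isGraphical_dSeparates hG).exists_nearest hM hsep hA⟩
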